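/- Let $X$ be a non-empty countable set, let $b\colon X\times X\to[0,\infty)$ satisfy $b(x,y)=b(y,x)$, $b(x,x)=0$ and $\sum_{z\in X}b(x,z)<\infty$ for all $x,y\in X$, and let $\mu\colon X\to(0,\infty)$. Assume that the weighted graph $(X,b,\mu)$ is connected, i.e. every two vertices are joined by a finite path $x_0,\dots,x_n$ with $b(x_j,x_{j+1})>0$, and that it satisfies the finiteness condition (FC): for every $x\in X$ the function $y\mapsto b(x,y)/\mu(y)$ belongs to the Hilbert space $\ell^2(X,\mu)$ of functions $f\colon X\to\mathbb{C}$ with $\sum_{x}\mu(x)|f(x)|^2<\infty$, with inner product $(f,g)=\sum_x\mu(x)f(x)\overline{g(x)}$. For $V\colon X\to\mathbb{R}$ let $\mathcal{L}_V$ be the operator in $\ell^2(X,\mu)$ whose domain is the space $C_c(X)$ of finitely supported functions and which acts by $$\mathcal{L}_Vf(x)=\frac1{\mu(x)}\sum_{y\in X}b(x,y)\,(f(x)-f(y))+V(x)f(x);$$ by (FC) it maps into $\ell^2(X,\mu)$, and it is symmetric. If $\mathcal{L}_V$ is lower semi-bounded, i.e. $(\mathcal{L}_Vu,u)\ge C\|u\|^2$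 for some $C\in\mathbb{R}$ and all $u\in C_c(X)$, then the form $u\mapsto(\mathcal{L}_Vu,u)$ on $C_c(X)$ is closable; let $h_V$ be its closure, and let the Friedrichs extension $L_V$ of $\mathcal{L}_V$ be the operator associated with the closed form $h_V$. (The operator $T$ associated with a densely defined, closed, lower semi-bounded form $t$ is given by: $Tu=f$ if and only if $u\in D(t)$ and $t(u,v)=(f,v)$ for all $v\in D(t)$.) Let $V_1,V_2\colon X\to\mathbb{R}$ with $V_2(x)\ge0$ for all $x\in X$, and assume that $\mathcal{L}_{V_1}$ is lower semi-bounded; then so is $\mathcal{L}_{V_1+V_2}$. Let $M_{V_2}u=V_2u$ be the maximal multiplication operator, with domain $\{u\in\ell^2(X,\mu): V_2u\in\ell^2(X,\mu)\}$; it is the operator associated with the closed form $q_{V_2}(u)=\sum_x\mu(x)V_2(x)|u(x)|^2$ with domain $\{u\in\ell^2(X,\mu):\sum_x\mu(x)V_2(x)|u(x)|^2<\infty\}$. Let the form-sum $L_{V_1}\widetilde{+}M_{V_2}$ be the operator associated with the closed form $h_{V_1}+q_{V_2}$ with domain $D(h_{V_1})\cap D(q_{V_2})$. Then $$L_{V_1}\widetilde{+}M_{V_2}=L_{V_1+V_2}.$$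 -/

import Mathlib

noncomputable section

open Filter Topology ComplexConjugate

/-! ### Lower semi-bounded Hermitian forms in a complex inner product space

Inner products and sesquilinear forms are conjugate-linear in the first variable
and linear in the second one. -/

/-- A lower semi-bounded Hermitian sesquilinear form in `H`. -/
structure SemiboundedForm (H : Type*) [NormedAddCommGroup H] [InnerProductSpace ℂ H] where
  domain : Submodule ℂ H
  form : domain →ₗ⋆[ℂ] domain →ₗ[ℂ] ℂ
  hermitian : ∀ u v, conj (form u v) = form v u
  lower_bound : ∃ c : ℝ, ∀ u : domain, c * ‖(u : H)‖ ^ 2 ≤ (form u u).re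

namespace SemiboundedForm

variable {H : Type*} [NormedAddCommGroup H] [InnerProductSpace ℂ H] (t : SemiboundedForm H)

/-- The quadratic form `u ↦ t(u, u)`. -/
def quad (u : t.domain) : ℝ := (t.form u u).re

/-- `u n ∈ D(t)` is `t`-convergent to `x ∈ H`: `u n → x` in `H` and
`t(u n - u m) → 0` as `n, m → ∞`. -/
def ConvergesTo (u : ℕ → t.domain) (x : H) : Prop :=
  Tendsto (fun n => (u n : H)) atTop (𝓝 x) ∧
    Tendsto (fun p : ℕ × ℕ => t.quad (u p.1 - u p.2)) atTop (𝓝 0)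

/-- The form `t` is closable: `t`-convergence of `u n` to `0` implies `t(u n) → 0`. -/
def IsClosable : Prop :=
  ∀ u : ℕ → t.domain, t.ConvergesTo u 0 → Tendsto (fun n => t.quad (u n)) atTop (𝓝 0)

/-- The form `t` is closed: if `u n` is `t`-convergent to `x`, then `x ∈ D(t)` and
`t(u n - x) → 0`. -/
def IsClosed : Prop :=
  ∀ (u : ℕ → t.domain) (x : H), t.ConvergesTo u x →
    ∃ hx : x ∈ t.domain, Tendsto (fun n => t.quad (u n - ⟨x, hx⟩)) atTop (𝓝 0)

/-- Some lower bound of `t`. -/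
def bound : ℝ := t.lower_bound.choose

/-- The domain of `t`, to be equipped with the form norm. -/
def FormSpace : Type _ := t.domain

instance : AddCommGroup t.FormSpace := inferInstanceAs (AddCommGroup t.domain)

instance : Module ℂ t.FormSpace := inferInstanceAs (Module ℂ t.domain)

/-- The identity, as a map from `D(t)` to `D(t)` with the form norm. -/
def toFS : t.domain ≃ₗ[ℂ] t.FormSpace := LinearEquiv.refl ℂ t.domain

/-- The inner product `t(u, v) + (1 - c) (u, v)` of the form norm, `c` a lower bound of `t`. -/
@[reducible]
def formCore : PreInnerProductSpace.Core ℂ t.FormSpace where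
  inner u v := t.form (t.toFS.symm u) (t.toFS.symm v) +
    ((1 - t.bound : ℝ) : ℂ) * inner ℂ (t.toFS.symm u : H) (t.toFS.symm v : H)
  conj_inner_symm u v := by
    simp only [map_add, map_mul, Complex.conj_ofReal, inner_conj_symm, t.hermitian]
  re_inner_nonneg u := by
    have h := t.lower_bound.choose_spec (t.toFS.symm u)
    have h2 : (inner ℂ (t.toFS.symm u : H) (t.toFS.symm u : H) : ℂ) =
        ((‖(t.toFS.symm u : H)‖ ^ 2 : ℝ) : ℂ) := by
      rw [inner_self_eq_norm_sq_to_K]; push_cast; rfl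
    rw [h2, ← Complex.ofReal_mul]
    simp only [RCLike.re_to_complex, Complex.add_re, Complex.ofReal_re]
    change t.bound * _ ≤ _ at h
    nlinarith [sq_nonneg ‖(t.toFS.symm u : H)‖]
  add_left u v w := by
    simp only [map_add, LinearMap.add_apply, Submodule.coe_add, inner_add_left]
    ring
  smul_left u v r := by
    simp only [map_smul, LinearMap.map_smulₛₗ₂, Submodule.coe_smul, inner_smul_left, smul_eq_mul]
    ring

instance : SeminormedAddCommGroup t.FormSpace :=
  @InnerProductSpace.Core.toSeminormedAddCommGroup ℂ t.FormSpace _ _ _ t.formCore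

instance : InnerProductSpace ℂ t.FormSpace := InnerProductSpace.ofCore t.formCore

theorem inner_toFS (u v : t.domain) :
    inner ℂ (t.toFS u) (t.toFS v) =
      t.form u v + ((1 - t.bound : ℝ) : ℂ) * inner ℂ (u : H) (v : H) := rfl

theorem norm_toFS_sq (u : t.domain) :
    ‖t.toFS u‖ ^ 2 = t.quad u + (1 - t.bound) * ‖(u : H)‖ ^ 2 := by
  have h2 : (inner ℂ (u : H) (u : H) : ℂ) = ((‖(u : H)‖ ^ 2 : ℝ) : ℂ) := by
    rw [inner_self_eq_norm_sq_to_K]; push_cast; rfl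
  rw [← inner_self_eq_norm_sq (𝕜 := ℂ), inner_toFS, h2, ← Complex.ofReal_mul]
  simp only [quad, RCLike.re_to_complex, Complex.add_re, Complex.ofReal_re]

theorem norm_le_norm_toFS (u : t.domain) : ‖(u : H)‖ ≤ ‖t.toFS u‖ := by
  refine (abs_le_of_sq_le_sq' ?_ (norm_nonneg _)).2
  have h : t.bound * ‖(u : H)‖ ^ 2 ≤ t.quad u := t.lower_bound.choose_spec u
  rw [norm_toFS_sq]
  nlinarith

theorem tendsto_toFS_iff {ι : Type*} {l : Filter ι} (z : ι → t.domain) :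
    Tendsto (fun i => ‖t.toFS (z i)‖) l (𝓝 0) ↔
      Tendsto (fun i => (z i : H)) l (𝓝 0) ∧ Tendsto (fun i => t.quad (z i)) l (𝓝 0) := by
  constructor
  · intro h
    have h1 : Tendsto (fun i => ‖(z i : H)‖) l (𝓝 0) :=
      squeeze_zero (fun _ => norm_nonneg _) (fun i => t.norm_le_norm_toFS (z i)) h
    refine ⟨tendsto_zero_iff_norm_tendsto_zero.2 h1, ?_⟩
    have h2 := (h.pow 2).sub ((h1.pow 2).const_mul (1 - t.bound))
    simp only [norm_toFS_sq] at h2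
    simpa using h2
  · rintro ⟨h1, h2⟩
    have h3 := h2.add ((h1.norm.pow 2).const_mul (1 - t.bound))
    simp only [← norm_toFS_sq] at h3
    have h4 := h3.sqrt
    simpa [Real.sqrt_sq] using h4

theorem convergesTo_iff (u : ℕ → t.domain) (x : H) :
    t.ConvergesTo u x ↔
      Tendsto (fun n => (u n : H)) atTop (𝓝 x) ∧ CauchySeq (fun n => t.toFS (u n)) := by
  refine and_congr_right fun hx => ?_
  rw [cauchySeq_iff_tendsto_dist_atTop_0]
  simp only [dist_eq_norm, ← map_sub]
  rw [t.tendsto_toFS_iff (fun p : ℕ × ℕ => u p.1 - u p.2)]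
  refine (and_iff_right ?_).symm
  rw [← prod_atTop_atTop_eq]
  simpa using (hx.comp tendsto_fst).sub (hx.comp tendsto_snd)

variable {t}

theorem ConvergesTo.add {u v : ℕ → t.domain} {x y : H} (hu : t.ConvergesTo u x)
    (hv : t.ConvergesTo v y) : t.ConvergesTo (fun n => u n + v n) (x + y) := by
  rw [convergesTo_iff] at *
  refine ⟨by simpa using hu.1.add hv.1, ?_⟩
  simp only [map_add]
  exact hu.2.add hv.2

theorem ConvergesTo.smul {u : ℕ → t.domain} {x : H} (c : ℂ) (hu : t.ConvergesTo u x) :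
    t.ConvergesTo (fun n => c • u n) (c • x) := by
  rw [convergesTo_iff] at *
  refine ⟨by simpa using hu.1.const_smul c, ?_⟩
  simp only [map_smul]
  exact (uniformContinuous_const_smul c).comp_cauchySeq hu.2

theorem ConvergesTo.sub {u v : ℕ → t.domain} {x y : H} (hu : t.ConvergesTo u x)
    (hv : t.ConvergesTo v y) : t.ConvergesTo (fun n => u n - v n) (x - y) := by
  simpa [sub_eq_add_neg] using hu.add (hv.smul (-1))

theorem convergesTo_const (u : t.domain) : t.ConvergesTo (fun _ => u) u := by
  rw [convergesTo_iff]
  exact ⟨tendsto_const_nhds, cauchySeq_const _⟩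

/-- A `t`-convergent sequence converges in the completion of the form norm. -/
theorem ConvergesTo.exists_lim {u : ℕ → t.domain} {x : H} (hu : t.ConvergesTo u x) :
    ∃ a : UniformSpace.Completion t.FormSpace,
      Tendsto (fun n => (t.toFS (u n) : UniformSpace.Completion t.FormSpace)) atTop (𝓝 a) :=
  cauchySeq_tendsto_of_complete
    (((convergesTo_iff t u x).1 hu).2.map (UniformSpace.Completion.uniformContinuous_coe _))

theorem tendsto_form {u v : ℕ → t.domain} {x y : H} (hu : t.ConvergesTo u x)
    (hv : t.ConvergesTo v y) {a b : UniformSpace.Completion t.FormSpace}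
    (ha : Tendsto (fun n => (t.toFS (u n) : UniformSpace.Completion t.FormSpace)) atTop (𝓝 a))
    (hb : Tendsto (fun n => (t.toFS (v n) : UniformSpace.Completion t.FormSpace)) atTop (𝓝 b)) :
    Tendsto (fun n => t.form (u n) (v n)) atTop
      (𝓝 (inner ℂ a b - ((1 - t.bound : ℝ) : ℂ) * inner ℂ x y)) := by
  have h1 := (ha.inner (𝕜 := ℂ) hb).sub
    ((hu.1.inner (𝕜 := ℂ) hv.1).const_mul ((1 - t.bound : ℝ) : ℂ))
  refine h1.congr fun n => ?_
  rw [UniformSpace.Completion.inner_coe, inner_toFS]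
  ring

theorem lim_unique (ht : t.IsClosable) {u v : ℕ → t.domain} {x : H} (hu : t.ConvergesTo u x)
    (hv : t.ConvergesTo v x) {a b : UniformSpace.Completion t.FormSpace}
    (ha : Tendsto (fun n => (t.toFS (u n) : UniformSpace.Completion t.FormSpace)) atTop (𝓝 a))
    (hb : Tendsto (fun n => (t.toFS (v n) : UniformSpace.Completion t.FormSpace)) atTop (𝓝 b)) :
    a = b := by
  have h0 : t.ConvergesTo (fun n => u n - v n) 0 := by simpa using hu.sub hv
  have h1 := (t.tendsto_toFS_iff (fun n => u n - v n)).2 ⟨h0.1, ht _ h0⟩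
  have h2 := (ha.sub hb).norm
  simp only [← UniformSpace.Completion.coe_sub, UniformSpace.Completion.norm_coe, ← map_sub] at h2
  exact sub_eq_zero.1 (norm_eq_zero.1 (tendsto_nhds_unique h2 h1))

variable (t)

/-- The domain of the closure: all limits of `t`-convergent sequences. -/
def closureDomain : Submodule ℂ H where
  carrier := {x | ∃ u : ℕ → t.domain, t.ConvergesTo u x}
  add_mem' := fun ⟨_, hu⟩ ⟨_, hv⟩ => ⟨_, hu.add hv⟩
  zero_mem' := ⟨_, convergesTo_const 0⟩
  smul_mem' := fun c _ ⟨_, hu⟩ => ⟨_, hu.smul c⟩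

/-- The value `lim t(u n, v n)` of the closure at `x`, `y`, where `u`, `v` are sequences that
are `t`-convergent to `x` and to `y`. If `t` is closable, then it does not depend on the choice of
the sequences. -/
def closureValue (x y : t.closureDomain) : ℂ :=
  limUnder atTop fun n => t.form (x.2.choose n) (y.2.choose n)

variable {t}

theorem tendsto_closureValue (ht : t.IsClosable) {x y : t.closureDomain} {u v : ℕ → t.domain}
    (hu : t.ConvergesTo u x) (hv : t.ConvergesTo v y) :
    Tendsto (fun n => t.form (u n) (v n)) atTop (𝓝 (t.closureValue x y)) := by
  have hx := x.2.choose_spec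
  have hy := y.2.choose_spec
  obtain ⟨a, ha⟩ := hu.exists_lim
  obtain ⟨b, hb⟩ := hv.exists_lim
  obtain ⟨a', ha'⟩ := hx.exists_lim
  obtain ⟨b', hb'⟩ := hy.exists_lim
  obtain rfl := lim_unique ht hu hx ha ha'
  obtain rfl := lim_unique ht hv hy hb hb'
  rw [closureValue, (tendsto_form hx hy ha' hb').limUnder_eq]
  exact tendsto_form hu hv ha hb

/-- The closure of a closable form. -/
def closure (t : SemiboundedForm H) (ht : t.IsClosable) : SemiboundedForm H where
  domain := t.closureDomain
  form := LinearMap.mk₂'ₛₗ _ _ t.closureValue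
    (fun x y z => by
      obtain ⟨u, hu⟩ := x.2
      obtain ⟨v, hv⟩ := y.2
      obtain ⟨w, hw⟩ := z.2
      refine tendsto_nhds_unique (tendsto_closureValue ht (hu.add hv) hw) ?_
      simpa using (tendsto_closureValue ht hu hw).add (tendsto_closureValue ht hv hw))
    (fun c x y => by
      obtain ⟨u, hu⟩ := x.2
      obtain ⟨v, hv⟩ := y.2
      refine tendsto_nhds_unique (tendsto_closureValue ht (hu.smul c) hv) ?_
      simpa using (tendsto_closureValue ht hu hv).const_mul (conj c))
    (fun x y z => by
      obtain ⟨u, hu⟩ := x.2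
      obtain ⟨v, hv⟩ := y.2
      obtain ⟨w, hw⟩ := z.2
      refine tendsto_nhds_unique (tendsto_closureValue ht hu (hv.add hw)) ?_
      simpa using (tendsto_closureValue ht hu hv).add (tendsto_closureValue ht hu hw))
    (fun c x y => by
      obtain ⟨u, hu⟩ := x.2
      obtain ⟨v, hv⟩ := y.2
      refine tendsto_nhds_unique (tendsto_closureValue ht hu (hv.smul c)) ?_
      simpa using (tendsto_closureValue ht hu hv).const_mul c)
  hermitian x y := by
    obtain ⟨u, hu⟩ := x.2
    obtain ⟨v, hv⟩ := y.2
    refine tendsto_nhds_unique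
      ((Complex.continuous_conj.tendsto _).comp (tendsto_closureValue ht hu hv)) ?_
    refine (tendsto_closureValue ht hv hu).congr fun n => ?_
    exact (t.hermitian _ _).symm
  lower_bound := by
    obtain ⟨c, hc⟩ := t.lower_bound
    refine ⟨c, fun x => ?_⟩
    obtain ⟨u, hu⟩ := x.2
    exact le_of_tendsto_of_tendsto' ((hu.1.norm.pow 2).const_mul c)
      ((Complex.continuous_re.tendsto _).comp (tendsto_closureValue ht hu hu)) fun n => hc (u n)

theorem domain_le_closure (ht : t.IsClosable) : t.domain ≤ (t.closure ht).domain :=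
  fun x hx => ⟨_, convergesTo_const ⟨x, hx⟩⟩

theorem closure_quad (ht : t.IsClosable) (u : t.domain) :
    (t.closure ht).quad (Submodule.inclusion (domain_le_closure ht) u) = t.quad u := by
  have h := tendsto_closureValue ht (x := Submodule.inclusion (domain_le_closure ht) u)
    (y := Submodule.inclusion (domain_le_closure ht) u) (convergesTo_const u) (convergesTo_const u)
  exact congrArg Complex.re (tendsto_nhds_unique h tendsto_const_nhds)

theorem tendsto_closure_quad_sub (ht : t.IsClosable) {u : ℕ → t.domain}
    {x : (t.closure ht).domain} (hu : t.ConvergesTo u x) :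
    Tendsto (fun n => (t.closure ht).quad
      (Submodule.inclusion (domain_le_closure ht) (u n) - x)) atTop (𝓝 0) := by
  have h1 : ∀ n, Tendsto (fun m => t.quad (u n - u m)) atTop
      (𝓝 ((t.closure ht).quad (Submodule.inclusion (domain_le_closure ht) (u n) - x))) := by
    intro n
    have h := (convergesTo_const (u n)).sub hu
    exact (Complex.continuous_re.tendsto _).comp (tendsto_closureValue ht
      (x := Submodule.inclusion (domain_le_closure ht) (u n) - x)
      (y := Submodule.inclusion (domain_le_closure ht) (u n) - x) h h)
  rw [Metric.tendsto_atTop]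
  intro ε hε
  obtain ⟨N, hN⟩ := Metric.tendsto_atTop.1 hu.2 (ε / 2) (by positivity)
  refine ⟨max N.1 N.2, fun n hn => ?_⟩
  refine lt_of_le_of_lt (le_of_tendsto ((h1 n).dist tendsto_const_nhds) ?_) (half_lt_self hε)
  filter_upwards [eventually_ge_atTop N.2] with m hm
  exact (hN (n, m) ⟨le_trans (le_max_left _ _) hn, hm⟩).le

theorem closure_isClosed (ht : t.IsClosable) : (t.closure ht).IsClosed := by
  let T := t.closure ht
  intro (x : ℕ → T.domain) y (hxy : T.ConvergesTo x y)
  let i := Submodule.inclusion (domain_le_closure ht)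
  have hex : ∀ n, ∃ w : t.domain, ‖T.toFS (i w - x n)‖ < 1 / ((n : ℝ) + 1) := by
    intro n
    obtain ⟨u, hu⟩ := (x n).2
    have h1 : Tendsto (fun k => ‖T.toFS (i (u k) - x n)‖) atTop (𝓝 0) := by
      rw [T.tendsto_toFS_iff]
      refine ⟨?_, tendsto_closure_quad_sub ht hu⟩
      simpa [i] using hu.1.sub_const (x n : H)
    obtain ⟨k, hk⟩ := (h1.eventually_lt_const (u := 1 / ((n : ℝ) + 1)) (by positivity)).exists
    exact ⟨u k, hk⟩
  choose w hw using hex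
  have hw0 : Tendsto (fun n => ‖T.toFS (i (w n) - x n)‖) atTop (𝓝 0) :=
    squeeze_zero (fun _ => norm_nonneg _) (fun n => (hw n).le)
      tendsto_one_div_add_atTop_nhds_zero_nat
  have hd := (T.tendsto_toFS_iff _).1 hw0
  have hwy : Tendsto (fun n => (w n : H)) atTop (𝓝 y) := by
    have h1 := hd.1.add hxy.1
    rw [zero_add] at h1
    refine h1.congr fun n => ?_
    simp [i]
  have hwC : CauchySeq (fun n => T.toFS (i (w n))) := by
    have h1 : CauchySeq (fun n => T.toFS (i (w n) - x n)) :=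
      (tendsto_zero_iff_norm_tendsto_zero.2 hw0).cauchySeq
    have h2 := h1.add ((T.convergesTo_iff x y).1 hxy).2
    have h3 : ((fun n => T.toFS (i (w n) - x n)) + fun n => T.toFS (x n)) =
        fun n => T.toFS (i (w n)) := by
      funext n
      simp
    rwa [h3] at h2
  have hwT : T.ConvergesTo (fun n => i (w n)) y := (T.convergesTo_iff _ _).2 ⟨hwy, hwC⟩
  have hwt : t.ConvergesTo w y := by
    refine ⟨hwy, hwT.2.congr fun p => ?_⟩
    rw [← closure_quad ht, map_sub]
  have hy : y ∈ T.domain := ⟨w, hwt⟩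
  refine ⟨hy, ?_⟩
  have h2 : Tendsto (fun n => ‖T.toFS (i (w n) - ⟨y, hy⟩)‖) atTop (𝓝 0) := by
    rw [T.tendsto_toFS_iff]
    refine ⟨?_, tendsto_closure_quad_sub ht (x := ⟨y, hy⟩) hwt⟩
    simpa [i] using hwy.sub_const y
  have h3 : Tendsto (fun n => ‖T.toFS (x n - ⟨y, hy⟩)‖) atTop (𝓝 0) := by
    refine squeeze_zero (fun _ => norm_nonneg _) (fun n => ?_) (by simpa using h2.add hw0)
    have : x n - ⟨y, hy⟩ = (i (w n) - ⟨y, hy⟩) - (i (w n) - x n) := by abel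
    rw [this, map_sub]
    exact norm_sub_le _ _
  exact ((T.tendsto_toFS_iff _).1 h3).2

/-- The sum of two forms, with domain `D(s) ∩ D(t)`. -/
def add (s t : SemiboundedForm H) : SemiboundedForm H where
  domain := s.domain ⊓ t.domain
  form := LinearMap.mk₂'ₛₗ _ _
    (fun u v => s.form ⟨u, u.2.1⟩ ⟨v, v.2.1⟩ + t.form ⟨u, u.2.2⟩ ⟨v, v.2.2⟩)
    (fun u v w => by
      have h1 := LinearMap.map_add₂ s.form ⟨u, u.2.1⟩ ⟨v, v.2.1⟩ ⟨w, w.2.1⟩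
      have h2 := LinearMap.map_add₂ t.form ⟨u, u.2.2⟩ ⟨v, v.2.2⟩ ⟨w, w.2.2⟩
      refine (congrArg₂ (· + ·) h1 h2).trans ?_
      ring)
    (fun c u v => by
      have h1 := LinearMap.map_smulₛₗ₂ s.form c ⟨u, u.2.1⟩ ⟨v, v.2.1⟩
      have h2 := LinearMap.map_smulₛₗ₂ t.form c ⟨u, u.2.2⟩ ⟨v, v.2.2⟩
      exact (congrArg₂ (· + ·) h1 h2).trans (smul_add _ _ _).symm)
    (fun u v w => by
      have h1 := map_add (s.form ⟨u, u.2.1⟩) ⟨v, v.2.1⟩ ⟨w, w.2.1⟩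
      have h2 := map_add (t.form ⟨u, u.2.2⟩) ⟨v, v.2.2⟩ ⟨w, w.2.2⟩
      refine (congrArg₂ (· + ·) h1 h2).trans ?_
      ring)
    (fun c u v => by
      have h1 := map_smul (s.form ⟨u, u.2.1⟩) c ⟨v, v.2.1⟩
      have h2 := map_smul (t.form ⟨u, u.2.2⟩) c ⟨v, v.2.2⟩
      exact (congrArg₂ (· + ·) h1 h2).trans (smul_add _ _ _).symm)
  hermitian u v := by
    simp only [LinearMap.mk₂'ₛₗ_apply, map_add, s.hermitian, t.hermitian]
  lower_bound := by
    obtain ⟨c, hc⟩ := s.lower_bound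
    obtain ⟨d, hd⟩ := t.lower_bound
    refine ⟨c + d, fun u => ?_⟩
    have h1 := hc ⟨u, u.2.1⟩
    have h2 := hd ⟨u, u.2.2⟩
    simp only [LinearMap.mk₂'ₛₗ_apply, Complex.add_re]
    simp only at h1 h2
    linarith

theorem add_isClosed {s t : SemiboundedForm H} (hs : s.IsClosed) (ht : t.IsClosed) :
    (s.add t).IsClosed := by
  intro (u : ℕ → (s.add t).domain) x hu
  obtain ⟨c, hc⟩ := s.lower_bound
  obtain ⟨d, hd⟩ := t.lower_bound
  obtain ⟨hux, hq⟩ := hu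
  let us : ℕ → s.domain := fun n => ⟨u n, (u n).2.1⟩
  let ut : ℕ → t.domain := fun n => ⟨u n, (u n).2.2⟩
  have hq' : Tendsto (fun p : ℕ × ℕ => s.quad (us p.1 - us p.2) + t.quad (ut p.1 - ut p.2))
      atTop (𝓝 0) := hq
  have hn : Tendsto (fun p : ℕ × ℕ => ‖(u p.1 : H) - u p.2‖ ^ 2) atTop (𝓝 0) := by
    rw [← prod_atTop_atTop_eq]
    simpa using (((hux.comp tendsto_fst).sub (hux.comp tendsto_snd)).norm).pow 2
  have hS : ∀ p : ℕ × ℕ, c * ‖(u p.1 : H) - u p.2‖ ^ 2 ≤ s.quad (us p.1 - us p.2) :=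
    fun p => hc (us p.1 - us p.2)
  have hT : ∀ p : ℕ × ℕ, d * ‖(u p.1 : H) - u p.2‖ ^ 2 ≤ t.quad (ut p.1 - ut p.2) :=
    fun p => hd (ut p.1 - ut p.2)
  have h1 : s.ConvergesTo us x := by
    refine ⟨hux, tendsto_of_tendsto_of_tendsto_of_le_of_le
      (by simpa using hn.const_mul c) (by simpa using hq'.sub (hn.const_mul d)) hS ?_⟩
    intro p
    have := hT p
    simp only
    linarith
  have h2 : t.ConvergesTo ut x := by
    refine ⟨hux, tendsto_of_tendsto_of_tendsto_of_le_of_le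
      (by simpa using hn.const_mul d) (by simpa using hq'.sub (hn.const_mul c)) hT ?_⟩
    intro p
    have := hS p
    simp only
    linarith
  obtain ⟨hxs, hs'⟩ := hs us x h1
  obtain ⟨hxt, ht'⟩ := ht ut x h2
  refine ⟨⟨hxs, hxt⟩, ?_⟩
  have h3 := hs'.add ht'
  rw [add_zero] at h3
  exact h3

end SemiboundedForm

/-- A densely defined, closed, lower semi-bounded Hermitian form in `H`. -/
structure ClosedForm (H : Type*) [NormedAddCommGroup H] [InnerProductSpace ℂ H]
    extends SemiboundedForm H where
  dense : Dense (domain : Set H)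
  closed : toSemiboundedForm.IsClosed

namespace ClosedForm

variable {H : Type*} [NormedAddCommGroup H] [InnerProductSpace ℂ H]

/-- The sum of two closed lower semi-bounded forms, with domain `D(s) ∩ D(t)`, provided that this
intersection is dense. -/
def add (s t : ClosedForm H) (hd : Dense ((s.domain ⊓ t.domain : Submodule ℂ H) : Set H)) :
    ClosedForm H where
  toSemiboundedForm := s.toSemiboundedForm.add t.toSemiboundedForm
  dense := hd
  closed := SemiboundedForm.add_isClosed s.closed t.closed

/-- The domain of the operator `T` associated with `t`: all `u ∈ D(t)` for which there is `f ∈ H`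
with `t(v, u) = (v, f)` for all `v ∈ D(t)`. -/
def operatorDomain (t : ClosedForm H) : Submodule ℂ H where
  carrier := {u | ∃ hu : u ∈ t.domain, ∃ f : H, ∀ v : t.domain, t.form v ⟨u, hu⟩ = inner ℂ (v : H) f}
  add_mem' := by
    rintro u u' ⟨hu, f, hf⟩ ⟨hu', f', hf'⟩
    refine ⟨add_mem hu hu', f + f', fun v => ?_⟩
    rw [inner_add_right, ← hf, ← hf', ← map_add]
    rfl
  zero_mem' := ⟨zero_mem _, 0, fun v => by
    rw [inner_zero_right]; exact map_zero (t.form v)⟩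
  smul_mem' := by
    rintro c u ⟨hu, f, hf⟩
    refine ⟨Submodule.smul_mem _ c hu, c • f, fun v => ?_⟩
    rw [inner_smul_right, ← hf, ← smul_eq_mul, ← map_smul]
    rfl

theorem operator_unique (t : ClosedForm H) {f g : H}
    (h : ∀ v : t.domain, inner ℂ (v : H) f = inner ℂ (v : H) g) : f = g :=
  t.dense.eq_of_inner_right ℂ fun v hv => h ⟨v, hv⟩

/-- The operator `T` associated with a closed form `t`: `T u = f` if and only if `u ∈ D(t)` and
`t(v, u) = (v, f)` for all `v ∈ D(t)`. -/
def operator (t : ClosedForm H) : H →ₗ.[ℂ] H where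
  domain := t.operatorDomain
  toFun :=
    { toFun := fun u => u.2.choose_spec.choose
      map_add' := fun u u' => t.operator_unique fun v => by
        rw [inner_add_right, ← (u + u').2.choose_spec.choose_spec v,
          ← u.2.choose_spec.choose_spec v, ← u'.2.choose_spec.choose_spec v, ← map_add]
        rfl
      map_smul' := fun c u => t.operator_unique fun v => by
        rw [RingHom.id_apply, inner_smul_right, ← (c • u).2.choose_spec.choose_spec v,
          ← u.2.choose_spec.choose_spec v, ← smul_eq_mul, ← map_smul]
        rfl }

/-- The form-sum of the operators associated with the closed forms `s` and `t`: the operator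
associated with the closed form `s + t`. -/
def formSum (s t : ClosedForm H) (hd : Dense ((s.domain ⊓ t.domain : Submodule ℂ H) : Set H)) :
    H →ₗ.[ℂ] H := (s.add t hd).operator

end ClosedForm

/-! ### The Friedrichs extension -/

section Friedrichs

variable {H : Type*} [NormedAddCommGroup H] [InnerProductSpace ℂ H]

/-- The operator `T` is lower semi-bounded: `(T u, u) ≥ C ‖u‖²` for all `u ∈ D(T)`. -/
def IsLowerSemibounded (T : H →ₗ.[ℂ] H) : Prop :=
  ∃ C : ℝ, ∀ u : T.domain, C * ‖(u : H)‖ ^ 2 ≤ (inner ℂ (T u) (u : H)).re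

/-- The form `(u, v) ↦ (u, T v)` with domain `D(T)` of a symmetric, lower semi-bounded operator. -/
def operatorForm (T : H →ₗ.[ℂ] H) (hs : T.IsFormalAdjoint T) (hb : IsLowerSemibounded T) :
    SemiboundedForm H where
  domain := T.domain
  form := LinearMap.mk₂'ₛₗ _ _ (fun u v => inner ℂ (u : H) (T v))
    (fun u v w => inner_add_left _ _ _)
    (fun c u v => inner_smul_left _ _ _)
    (fun u v w => by rw [T.map_add, inner_add_right])
    (fun c u v => by rw [T.map_smul, inner_smul_right]; rfl)
  hermitian u v := by
    simp only [LinearMap.mk₂'ₛₗ_apply, inner_conj_symm]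
    exact hs v u
  lower_bound := by
    obtain ⟨C, hC⟩ := hb
    refine ⟨C, fun u => ?_⟩
    simp only [LinearMap.mk₂'ₛₗ_apply]
    rw [← hs u u]
    exact hC u

theorem operatorForm_isClosable (T : H →ₗ.[ℂ] H) (hs : T.IsFormalAdjoint T)
    (hb : IsLowerSemibounded T) : (operatorForm T hs hb).IsClosable := by
  let t := operatorForm T hs hb
  intro (u : ℕ → t.domain) (hu : t.ConvergesTo u 0)
  obtain ⟨a, ha⟩ := hu.exists_lim
  have h0 : ∀ v : t.domain, inner ℂ a (t.toFS v : UniformSpace.Completion t.FormSpace) = 0 := by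
    intro v
    have h1 := SemiboundedForm.tendsto_form hu (SemiboundedForm.convergesTo_const v) ha tendsto_const_nhds
    have h2 : Tendsto (fun n => t.form (u n) v) atTop (𝓝 (inner ℂ (0 : H) (T v))) :=
      hu.1.inner tendsto_const_nhds
    simpa using tendsto_nhds_unique h1 h2
  have ha0 : a = 0 := by
    refine UniformSpace.Completion.denseRange_coe.eq_zero_of_inner_left ℂ ?_
    intro v
    exact h0 (t.toFS.symm v)
  have h3 := ha.norm
  simp only [ha0, norm_zero, UniformSpace.Completion.norm_coe] at h3
  exact ((t.tendsto_toFS_iff u).1 h3).2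

/-- The closure of the form `(u, v) ↦ (u, T v)`, `u, v ∈ D(T)`, of a densely defined, symmetric,
lower semi-bounded operator. -/
def friedrichsForm (T : H →ₗ.[ℂ] H) (hd : Dense (T.domain : Set H)) (hs : T.IsFormalAdjoint T)
    (hb : IsLowerSemibounded T) : ClosedForm H where
  toSemiboundedForm := (operatorForm T hs hb).closure (operatorForm_isClosable T hs hb)
  dense := hd.mono (SemiboundedForm.domain_le_closure (operatorForm_isClosable T hs hb))
  closed := SemiboundedForm.closure_isClosed (operatorForm_isClosable T hs hb)

/-- The Friedrichs extension of a densely defined, symmetric, lower semi-bounded operator. -/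
def friedrichsExtension (T : H →ₗ.[ℂ] H) (hd : Dense (T.domain : Set H))
    (hs : T.IsFormalAdjoint T) (hb : IsLowerSemibounded T) : H →ₗ.[ℂ] H :=
  (friedrichsForm T hd hs hb).operator

end Friedrichs

/-! ### Weighted graphs and their Schrödinger operators -/

/-- A weighted graph `(X, b, μ)`: a symmetric edge weight `b` that vanishes on the diagonal and
is summable at each vertex, and a positive vertex weight `μ`. -/
structure WeightedGraph (X : Type*) where
  b : X → X → ℝ
  b_nonneg : ∀ x y, 0 ≤ b x y
  b_symm : ∀ x y, b x y = b y x
  b_self : ∀ x, b x x = 0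
  b_summable : ∀ x, Summable fun y => b x y
  μ : X → ℝ
  μ_pos : ∀ x, 0 < μ x

/-- The functions `f` on `X` with `∑ x, w x * |f x|² < ∞`, for a weight `w ≥ 0`. -/
def weightedEllTwo {X : Type*} (w : X → ℝ) (hw : ∀ x, 0 ≤ w x) : Submodule ℂ (X → ℂ) where
  carrier := {f | Summable fun x => w x * ‖f x‖ ^ 2}
  add_mem' := by
    intro f g (hf : Summable _) (hg : Summable _)
    refine Summable.of_nonneg_of_le (fun x => mul_nonneg (hw x) (sq_nonneg _)) (fun x => ?_)
      ((hf.mul_left 2).add (hg.mul_left 2))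
    have h1 : ‖f x + g x‖ ^ 2 ≤ 2 * ‖f x‖ ^ 2 + 2 * ‖g x‖ ^ 2 := by
      have := norm_add_le (f x) (g x)
      nlinarith [sq_nonneg (‖f x‖ - ‖g x‖), norm_nonneg (f x + g x)]
    have := mul_le_mul_of_nonneg_left h1 (hw x)
    simp only [Pi.add_apply]
    linarith
  zero_mem' := by simp
  smul_mem' := by
    intro c f (hf : Summable _)
    refine (hf.mul_left (‖c‖ ^ 2)).congr fun x => ?_
    simp only [Pi.smul_apply, smul_eq_mul, norm_mul]
    ring

theorem summable_weighted_mul {X : Type*} {w : X → ℝ} (hw : ∀ x, 0 ≤ w x) {f g : X → ℂ}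
    (hf : f ∈ weightedEllTwo w hw) (hg : g ∈ weightedEllTwo w hw) :
    Summable fun x => (w x : ℂ) * (conj (f x) * g x) := by
  have hf' : Summable fun x => w x * ‖f x‖ ^ 2 := hf
  have hg' : Summable fun x => w x * ‖g x‖ ^ 2 := hg
  refine Summable.of_norm_bounded (hf'.add hg') fun x => ?_
  rw [norm_mul, norm_mul, Complex.norm_real, Real.norm_of_nonneg (hw x), RCLike.norm_conj,
    ← mul_add]
  refine mul_le_mul_of_nonneg_left ?_ (hw x)
  nlinarith [sq_nonneg (‖f x‖ - ‖g x‖), sq_nonneg ‖f x‖, sq_nonneg ‖g x‖]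

theorem weighted_mul_self {X : Type*} (w : X → ℝ) (f : X → ℂ) :
    (∑' x, (w x : ℂ) * (conj (f x) * f x)).re = ∑' x, w x * ‖f x‖ ^ 2 := by
  rw [← Complex.ofReal_re (∑' x, w x * ‖f x‖ ^ 2), Complex.ofReal_tsum]
  congr 2
  funext x
  rw [Complex.conj_mul']
  push_cast
  rfl

namespace WeightedGraph

variable {X : Type*} (G : WeightedGraph X)

/-- Every two vertices are joined by a finite path `x₀, …, xₙ` with `b(xⱼ, xⱼ₊₁) > 0`. -/
def Connected : Prop := ∀ x y, Relation.ReflTransGen (fun p q => 0 < G.b p q) x y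

/-- The functions `f` on `X` with `∑ x, μ x * |f x|² < ∞`. -/
def ellTwo : Submodule ℂ (X → ℂ) := weightedEllTwo G.μ fun x => (G.μ_pos x).le

/-- The Hilbert space `ℓ²(X, μ)`. -/
def L2 : Type _ := G.ellTwo

instance : AddCommGroup G.L2 := inferInstanceAs (AddCommGroup G.ellTwo)

instance : Module ℂ G.L2 := inferInstanceAs (Module ℂ G.ellTwo)

/-- An element of `ℓ²(X, μ)` as a function on `X`. -/
def toFun : G.L2 →ₗ[ℂ] (X → ℂ) := G.ellTwo.subtype

/-- A square summable function as an element of `ℓ²(X, μ)`. -/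
def mkL2 (f : X → ℂ) (hf : f ∈ G.ellTwo) : G.L2 := ⟨f, hf⟩

instance : CoeFun G.L2 fun _ => X → ℂ := ⟨fun f => G.toFun f⟩

variable {G}

@[simp] theorem mkL2_apply (f : X → ℂ) (hf : f ∈ G.ellTwo) (x : X) : G.mkL2 f hf x = f x := rfl

@[simp] theorem L2.add_apply (f g : G.L2) (x : X) : (f + g) x = f x + g x := rfl

@[simp] theorem L2.sub_apply (f g : G.L2) (x : X) : (f - g) x = f x - g x := rfl

@[simp] theorem L2.smul_apply (c : ℂ) (f : G.L2) (x : X) : (c • f) x = c * f x := rfl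

@[simp] theorem L2.zero_apply (x : X) : (0 : G.L2) x = 0 := rfl

theorem L2.mem (f : G.L2) : G.toFun f ∈ G.ellTwo := f.2

theorem L2.ext {f g : G.L2} (h : ∀ x, f x = g x) : f = g := Subtype.ext (funext h)

variable (G)

/-- The inner product `∑ x, μ x * conj (f x) * g x` of `ℓ²(X, μ)`. -/
@[reducible]
def core : InnerProductSpace.Core ℂ G.L2 where
  inner f g := ∑' x, (G.μ x : ℂ) * (conj (f x) * g x)
  conj_inner_symm f g := by
    rw [Complex.conj_tsum]
    refine tsum_congr fun x => ?_
    simp only [map_mul, Complex.conj_ofReal, Complex.conj_conj]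
    ring
  re_inner_nonneg f := by
    rw [RCLike.re_to_complex, weighted_mul_self]
    exact tsum_nonneg fun x => mul_nonneg (G.μ_pos x).le (sq_nonneg _)
  add_left f g h := by
    rw [← (summable_weighted_mul _ f.mem h.mem).tsum_add (summable_weighted_mul _ g.mem h.mem)]
    refine tsum_congr fun x => ?_
    simp only [L2.add_apply, map_add]
    ring
  smul_left f g c := by
    rw [← tsum_mul_left]
    refine tsum_congr fun x => ?_
    simp only [L2.smul_apply, map_mul]
    ring
  definite f hf := by
    have h1 := congrArg Complex.re hf
    rw [weighted_mul_self, Complex.zero_re] at h1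
    have h2 : Summable fun x => G.μ x * ‖f x‖ ^ 2 := f.mem
    refine L2.ext fun x => ?_
    have h3 := h2.le_tsum x fun y _ => mul_nonneg (G.μ_pos y).le (sq_nonneg _)
    have h4 : 0 ≤ ‖f x‖ ^ 2 := sq_nonneg _
    have h5 : ‖f x‖ ^ 2 = 0 := by nlinarith [G.μ_pos x]
    simpa using h5

instance : NormedAddCommGroup G.L2 := G.core.toNormedAddCommGroup

instance : InnerProductSpace ℂ G.L2 := InnerProductSpace.ofCore G.core.toCore

theorem inner_def (f g : G.L2) : inner ℂ f g = ∑' x, (G.μ x : ℂ) * (conj (f x) * g x) := rfl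

theorem norm_sq_eq (f : G.L2) : ‖f‖ ^ 2 = ∑' x, G.μ x * ‖f x‖ ^ 2 := by
  rw [← inner_self_eq_norm_sq (𝕜 := ℂ), inner_def, RCLike.re_to_complex, weighted_mul_self]

theorem mul_norm_sq_le (f : G.L2) (x : X) : G.μ x * ‖f x‖ ^ 2 ≤ ‖f‖ ^ 2 := by
  have h2 : Summable fun x => G.μ x * ‖f x‖ ^ 2 := f.mem
  rw [norm_sq_eq]
  exact h2.le_tsum x fun y _ => mul_nonneg (G.μ_pos y).le (sq_nonneg _)

theorem tendsto_apply {ι : Type*} {l : Filter ι} {u : ι → G.L2} {f : G.L2}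
    (h : Tendsto u l (𝓝 f)) (x : X) : Tendsto (fun i => u i x) l (𝓝 (f x)) := by
  rw [tendsto_iff_norm_sub_tendsto_zero] at h ⊢
  have h1 : Tendsto (fun i => (G.μ x)⁻¹ * ‖u i - f‖ ^ 2) l (𝓝 0) := by
    simpa using (h.pow 2).const_mul (G.μ x)⁻¹
  have h2 : Tendsto (fun i => ‖u i x - f x‖ ^ 2) l (𝓝 0) := by
    refine squeeze_zero (fun _ => sq_nonneg _) (fun i => ?_) h1
    rw [le_inv_mul_iff₀ (G.μ_pos x)]
    exact G.mul_norm_sq_le (u i - f) x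
  simpa [Real.sqrt_sq] using h2.sqrt

theorem mem_ellTwo_of_finite {f : X → ℂ} (hf : f.support.Finite) : f ∈ G.ellTwo := by
  refine summable_of_hasFiniteSupport (hf.subset fun x hx => ?_)
  contrapose! hx
  simp [Function.notMem_support.1 hx]

/-- `C_c(X)`: the finitely supported functions, as a subspace of `ℓ²(X, μ)`. -/
def finSupp : Submodule ℂ G.L2 where
  carrier := {f | (G.toFun f).support.Finite}
  add_mem' := fun hf hg => (hf.union hg).subset (Function.support_add _ _)
  zero_mem' := by simp
  smul_mem' := fun c _ hf => hf.subset (Function.support_const_smul_subset c _)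

theorem dense_finSupp : Dense (G.finSupp : Set G.L2) := by
  classical
  intro f
  rw [Metric.mem_closure_iff]
  intro ε hε
  have hf : Summable fun x => G.μ x * ‖f x‖ ^ 2 := f.mem
  obtain ⟨s, hs⟩ := (hf.hasSum.eventually (lt_mem_nhds
    (sub_lt_self (∑' x, G.μ x * ‖f x‖ ^ 2) (pow_pos hε 2)))).exists
  let g : X → ℂ := fun x => if x ∈ s then f x else 0
  have hg : g.support.Finite := s.finite_toSet.subset fun x hx => by
    by_contra h
    exact hx (if_neg h)
  refine ⟨G.mkL2 g (G.mem_ellTwo_of_finite hg), hg, ?_⟩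
  rw [dist_eq_norm]
  refine lt_of_pow_lt_pow_left₀ 2 hε.le ?_
  rw [norm_sq_eq]
  have h1 : ∑' x, G.μ x * ‖(f - G.mkL2 g (G.mem_ellTwo_of_finite hg)) x‖ ^ 2 =
      ∑' x, (G.μ x * ‖f x‖ ^ 2 - if x ∈ s then G.μ x * ‖f x‖ ^ 2 else 0) := by
    refine tsum_congr fun x => ?_
    simp only [L2.sub_apply, mkL2_apply, g]
    split_ifs <;> simp
  have h2 : HasSum (fun x => if x ∈ s then G.μ x * ‖f x‖ ^ 2 else 0)
      (∑ x ∈ s, G.μ x * ‖f x‖ ^ 2) := by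
    have h3 : ∑ x ∈ s, G.μ x * ‖f x‖ ^ 2 =
        ∑ x ∈ s, if x ∈ s then G.μ x * ‖f x‖ ^ 2 else 0 :=
      Finset.sum_congr rfl fun x hx => (if_pos hx).symm
    rw [h3]
    exact hasSum_sum_of_ne_finset_zero fun x hx => if_neg hx
  rw [h1, (hf.hasSum.sub h2).tsum_eq]
  linarith

/-- The finiteness condition: `y ↦ b(x, y) / μ(y)` belongs to `ℓ²(X, μ)` for all `x`. -/
def FinitenessCondition : Prop :=
  ∀ x, (fun y => ((G.b x y / G.μ y : ℝ) : ℂ)) ∈ G.ellTwo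

/-- The formal Schrödinger operator
`f ↦ (x ↦ (1 / μ(x)) ∑ y, b(x, y) (f(x) - f(y)) + V(x) f(x))`. The sum converges absolutely for
the functions `f` with `∑ y, b(x, y) |f(y)| < ∞` for all `x`, in particular for those with finite
support, the only ones to which it is applied here. -/
def formalSchrodinger (V : X → ℝ) (f : X → ℂ) (x : X) : ℂ :=
  1 / (G.μ x : ℂ) * ∑' y, (G.b x y : ℂ) * (f x - f y) + (V x : ℂ) * f x

theorem hasSum_laplacian {f : X → ℂ} {s : Finset X} (hs : f.support ⊆ s) (x : X) :
    HasSum (fun y => (G.b x y : ℂ) * (f x - f y))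
      (((∑' y, G.b x y : ℝ) : ℂ) * f x - ∑ y ∈ s, (G.b x y : ℂ) * f y) := by
  have h1 : HasSum (fun y => (G.b x y : ℂ) * f x) (((∑' y, G.b x y : ℝ) : ℂ) * f x) :=
    (Complex.hasSum_ofReal.2 (G.b_summable x).hasSum).mul_right (f x)
  have h2 : HasSum (fun y => (G.b x y : ℂ) * f y) (∑ y ∈ s, (G.b x y : ℂ) * f y) := by
    refine hasSum_sum_of_ne_finset_zero fun y hy => ?_
    have : f y = 0 := by
      by_contra h
      exact hy (hs h)
    simp [this]
  simpa [mul_sub] using h1.sub h2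

theorem formalSchrodinger_eq (V : X → ℝ) {f : X → ℂ} {s : Finset X} (hs : f.support ⊆ s) (x : X) :
    G.formalSchrodinger V f x =
      (((∑' y, G.b x y : ℝ) : ℂ) / (G.μ x : ℂ) + (V x : ℂ)) * f x -
        ∑ y ∈ s, f y * ((G.b y x / G.μ x : ℝ) : ℂ) := by
  rw [formalSchrodinger, (G.hasSum_laplacian hs x).tsum_eq, mul_sub, Finset.mul_sum]
  have : ∑ y ∈ s, 1 / (G.μ x : ℂ) * ((G.b x y : ℂ) * f y) =
      ∑ y ∈ s, f y * ((G.b y x / G.μ x : ℝ) : ℂ) := by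
    refine Finset.sum_congr rfl fun y _ => ?_
    rw [G.b_symm x y]
    push_cast
    ring
  rw [this]
  ring

variable {G}

theorem formalSchrodinger_mem (hFC : G.FinitenessCondition) (V : X → ℝ) {f : X → ℂ}
    (hf : f.support.Finite) : G.formalSchrodinger V f ∈ G.ellTwo := by
  have h : G.formalSchrodinger V f =
      (fun x => (((∑' y, G.b x y : ℝ) : ℂ) / (G.μ x : ℂ) + (V x : ℂ)) * f x) -
        ∑ y ∈ hf.toFinset, f y • (fun x => ((G.b y x / G.μ x : ℝ) : ℂ)) := by
    funext x
    rw [G.formalSchrodinger_eq V (s := hf.toFinset) (by simp) x]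
    simp
  rw [h]
  refine sub_mem (G.mem_ellTwo_of_finite (hf.subset fun x hx => ?_))
    (sum_mem fun y _ => Submodule.smul_mem _ _ (hFC y))
  exact right_ne_zero_of_mul hx

/-- The Schrödinger operator with potential `V` and domain `C_c(X)`, as an operator in
`ℓ²(X, μ)`. -/
def schrodinger (hFC : G.FinitenessCondition) (V : X → ℝ) : G.L2 →ₗ.[ℂ] G.L2 where
  domain := G.finSupp
  toFun :=
    { toFun := fun f => G.mkL2 (G.formalSchrodinger V (f : G.L2)) (formalSchrodinger_mem hFC V f.2)
      map_add' := by
        intro f g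
        refine L2.ext fun x => ?_
        have hf' : (G.toFun (f : G.L2)).support.Finite := f.2
        have hf := G.hasSum_laplacian hf'.coe_toFinset.ge x
        have hg' : (G.toFun (g : G.L2)).support.Finite := g.2
        have hg := G.hasSum_laplacian hg'.coe_toFinset.ge x
        have h : ∑' y, (G.b x y : ℂ) * (((f + g : G.finSupp) : G.L2) x - ((f + g : G.finSupp) : G.L2) y)
            = ∑' y, (G.b x y : ℂ) * ((f : G.L2) x - (f : G.L2) y) +
              ∑' y, (G.b x y : ℂ) * ((g : G.L2) x - (g : G.L2) y) := by
          rw [← hf.summable.tsum_add hg.summable]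
          refine tsum_congr fun y => ?_
          simp only [Submodule.coe_add, L2.add_apply]
          ring
        simp only [mkL2_apply, L2.add_apply, formalSchrodinger, h]
        simp only [Submodule.coe_add, L2.add_apply]
        ring
      map_smul' := by
        intro c f
        refine L2.ext fun x => ?_
        have h : ∑' y, (G.b x y : ℂ) * (((c • f : G.finSupp) : G.L2) x - ((c • f : G.finSupp) : G.L2) y)
            = c * ∑' y, (G.b x y : ℂ) * ((f : G.L2) x - (f : G.L2) y) := by
          rw [← tsum_mul_left]
          refine tsum_congr fun y => ?_
          simp only [Submodule.coe_smul, L2.smul_apply]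
          ring
        simp only [mkL2_apply, RingHom.id_apply, L2.smul_apply, formalSchrodinger, h]
        simp only [Submodule.coe_smul, L2.smul_apply]
        ring }

theorem schrodinger_apply (hFC : G.FinitenessCondition) (V : X → ℝ) (f : G.finSupp) (x : X) :
    (schrodinger hFC V f) x = G.formalSchrodinger V (f : G.L2) x := rfl

theorem schrodinger_symmetric (hFC : G.FinitenessCondition) (V : X → ℝ) :
    (schrodinger hFC V).IsFormalAdjoint (schrodinger hFC V) := by
  classical
  intro (u : G.finSupp) (v : G.finSupp)
  have hu' : (G.toFun (u : G.L2)).support.Finite := u.2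
  have hv' : (G.toFun (v : G.L2)).support.Finite := v.2
  let s : Finset X := hu'.toFinset ∪ hv'.toFinset
  have hu : (G.toFun (u : G.L2)).support ⊆ s := fun x hx =>
    Finset.mem_union_left _ (hu'.mem_toFinset.2 hx)
  have hv : (G.toFun (v : G.L2)).support ⊆ s := fun x hx =>
    Finset.mem_union_right _ (hv'.mem_toFinset.2 hx)
  have hu0 : ∀ x ∉ s, (u : G.L2) x = 0 := fun x hx => by
    by_contra h
    exact hx (hu h)
  have hv0 : ∀ x ∉ s, (v : G.L2) x = 0 := fun x hx => by
    by_contra h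
    exact hx (hv h)
  rw [inner_def, inner_def, tsum_eq_sum (s := s) fun x hx => by simp [hv0 x hx],
    tsum_eq_sum (s := s) fun x hx => by simp [hu0 x hx]]
  have hμ : ∀ x, (G.μ x : ℂ) ≠ 0 := fun x => Complex.ofReal_ne_zero.2 (G.μ_pos x).ne'
  have hL : ∀ x, (G.μ x : ℂ) * (conj ((schrodinger hFC V u) x) * (v : G.L2) x) =
      (((∑' y, G.b x y : ℝ) : ℂ) + (G.μ x : ℂ) * (V x : ℂ)) * (conj ((u : G.L2) x) * (v : G.L2) x) -
        ∑ y ∈ s, (G.b y x : ℂ) * (conj ((u : G.L2) y) * (v : G.L2) x) := by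
    intro x
    rw [schrodinger_apply, G.formalSchrodinger_eq V hu, map_sub, map_sum]
    simp only [map_mul, map_add, map_div₀, Complex.conj_ofReal, Complex.ofReal_div]
    rw [sub_mul, mul_sub, Finset.sum_mul, Finset.mul_sum]
    congr 1
    · field_simp [hμ x]
    · refine Finset.sum_congr rfl fun y _ => ?_
      field_simp [hμ x]
  have hR : ∀ x, (G.μ x : ℂ) * (conj ((u : G.L2) x) * (schrodinger hFC V v) x) =
      (((∑' y, G.b x y : ℝ) : ℂ) + (G.μ x : ℂ) * (V x : ℂ)) * (conj ((u : G.L2) x) * (v : G.L2) x) -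
        ∑ y ∈ s, (G.b y x : ℂ) * (conj ((u : G.L2) x) * (v : G.L2) y) := by
    intro x
    rw [schrodinger_apply, G.formalSchrodinger_eq V hv]
    simp only [Complex.ofReal_div]
    rw [mul_sub, mul_sub, Finset.mul_sum, Finset.mul_sum]
    congr 1
    · field_simp [hμ x]
    · refine Finset.sum_congr rfl fun y _ => ?_
      field_simp [hμ x]
  rw [Finset.sum_congr rfl fun x _ => hL x, Finset.sum_congr rfl fun x _ => hR x,
    Finset.sum_sub_distrib, Finset.sum_sub_distrib, Finset.sum_comm]
  simp only [G.b_symm]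

theorem schrodinger_add_lowerSemibounded (hFC : G.FinitenessCondition) {V₁ V₂ : X → ℝ}
    (hV₂ : ∀ x, 0 ≤ V₂ x) (hb : IsLowerSemibounded (schrodinger hFC V₁)) :
    IsLowerSemibounded (schrodinger hFC (V₁ + V₂)) := by
  obtain ⟨C, hC⟩ := hb
  refine ⟨C, fun (u : G.finSupp) => (hC u).trans ?_⟩
  let w : G.L2 := G.mkL2 (fun x => (V₂ x : ℂ) * (u : G.L2) x)
    (G.mem_ellTwo_of_finite (Set.Finite.subset u.2 fun x hx => right_ne_zero_of_mul hx))
  have h : schrodinger hFC (V₁ + V₂) u = schrodinger hFC V₁ u + w := by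
    refine L2.ext fun x => ?_
    rw [L2.add_apply, schrodinger_apply, schrodinger_apply]
    simp only [formalSchrodinger, Pi.add_apply, w, mkL2_apply]
    push_cast
    ring
  rw [h, inner_add_left, Complex.add_re]
  refine le_add_of_nonneg_right ?_
  have h2 : inner ℂ w (u : G.L2) = ∑' x, ((G.μ x * V₂ x : ℝ) : ℂ) *
      (conj ((u : G.L2) x) * (u : G.L2) x) := by
    rw [inner_def]
    refine tsum_congr fun x => ?_
    simp only [w, mkL2_apply, map_mul, Complex.conj_ofReal]
    push_cast
    ring
  rw [h2, weighted_mul_self fun x => G.μ x * V₂ x]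
  exact tsum_nonneg fun x =>
    mul_nonneg (mul_nonneg (G.μ_pos x).le (hV₂ x)) (sq_nonneg _)

/-! ### Multiplication by a non-negative function -/

/-- The form `q(u, v) = ∑ x, μ(x) V(x) conj (u(x)) v(x)` of multiplication by `V ≥ 0`, with domain
`{u ∈ ℓ²(X, μ) | ∑ x, μ(x) V(x) |u(x)|² < ∞}`. -/
def mulForm (G : WeightedGraph X) (V : X → ℝ) (hV : ∀ x, 0 ≤ V x) : SemiboundedForm G.L2 where
  domain := (weightedEllTwo (fun x => G.μ x * V x)
    fun x => mul_nonneg (G.μ_pos x).le (hV x)).comap G.toFun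
  form := LinearMap.mk₂'ₛₗ _ _
    (fun u v => ∑' x, ((G.μ x * V x : ℝ) : ℂ) * (conj ((u : G.L2) x) * (v : G.L2) x))
    (fun u v w => by
      rw [← (summable_weighted_mul (fun x => mul_nonneg (G.μ_pos x).le (hV x)) u.2 w.2).tsum_add
        (summable_weighted_mul (fun x => mul_nonneg (G.μ_pos x).le (hV x)) v.2 w.2)]
      refine tsum_congr fun x => ?_
      simp only [Submodule.coe_add, L2.add_apply, map_add]
      ring)
    (fun c u v => by
      rw [smul_eq_mul, ← tsum_mul_left]
      refine tsum_congr fun x => ?_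
      simp only [Submodule.coe_smul, L2.smul_apply, map_mul]
      ring)
    (fun u v w => by
      rw [← (summable_weighted_mul (fun x => mul_nonneg (G.μ_pos x).le (hV x)) u.2 v.2).tsum_add
        (summable_weighted_mul (fun x => mul_nonneg (G.μ_pos x).le (hV x)) u.2 w.2)]
      refine tsum_congr fun x => ?_
      simp only [Submodule.coe_add, L2.add_apply]
      ring)
    (fun c u v => by
      rw [smul_eq_mul, ← tsum_mul_left]
      refine tsum_congr fun x => ?_
      simp only [Submodule.coe_smul, L2.smul_apply, RingHom.id_apply]
      ring)
  hermitian u v := by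
    simp only [LinearMap.mk₂'ₛₗ_apply]
    rw [Complex.conj_tsum]
    refine tsum_congr fun x => ?_
    simp only [map_mul, Complex.conj_ofReal, Complex.conj_conj]
    ring
  lower_bound := ⟨0, fun u => by
    rw [LinearMap.mk₂'ₛₗ_apply, weighted_mul_self (fun x => G.μ x * V x), zero_mul]
    exact tsum_nonneg fun x => mul_nonneg (mul_nonneg (G.μ_pos x).le (hV x)) (sq_nonneg _)⟩

theorem mulForm_quad (V : X → ℝ) (hV : ∀ x, 0 ≤ V x) (u : (G.mulForm V hV).domain) :
    (G.mulForm V hV).quad u = ∑' x, G.μ x * V x * ‖(u : G.L2) x‖ ^ 2 :=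
  weighted_mul_self (fun x => G.μ x * V x) _

theorem finSupp_le_mulForm (V : X → ℝ) (hV : ∀ x, 0 ≤ V x) :
    G.finSupp ≤ (G.mulForm V hV).domain := by
  intro u hu
  refine summable_of_hasFiniteSupport (Set.Finite.subset hu fun x hx => ?_)
  contrapose! hx
  simp [Function.notMem_support.1 hx]

theorem mulForm_isClosed (V : X → ℝ) (hV : ∀ x, 0 ≤ V x) : (G.mulForm V hV).IsClosed := by
  intro u f hu
  obtain ⟨huf, hq⟩ := hu
  have hw : ∀ x, 0 ≤ G.μ x * V x := fun x => mul_nonneg (G.μ_pos x).le (hV x)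
  have hsum : ∀ v : (G.mulForm V hV).domain,
      Summable fun x => G.μ x * V x * ‖(v : G.L2) x‖ ^ 2 := fun v => v.2
  have key : ∀ ε > 0, ∃ N, ∀ n ≥ N, ∀ s : Finset X,
      ∑ x ∈ s, G.μ x * V x * ‖((u n : G.L2) - f) x‖ ^ 2 ≤ ε := by
    intro ε hε
    obtain ⟨N, hN⟩ := Metric.tendsto_atTop.1 hq ε hε
    refine ⟨max N.1 N.2, fun n hn s => ?_⟩
    have h1 : Tendsto (fun m => ∑ x ∈ s, G.μ x * V x * ‖((u n : G.L2) - u m) x‖ ^ 2) atTop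
        (𝓝 (∑ x ∈ s, G.μ x * V x * ‖((u n : G.L2) - f) x‖ ^ 2)) := by
      refine tendsto_finsetSum _ fun x _ => Tendsto.const_mul _ ?_
      simp only [L2.sub_apply]
      exact ((tendsto_const_nhds.sub (G.tendsto_apply huf x)).norm).pow 2
    refine le_of_tendsto h1 ?_
    filter_upwards [eventually_ge_atTop N.2] with m hm
    have h2 := hN (n, m) ⟨le_trans (le_max_left _ _) hn, hm⟩
    rw [Real.dist_eq, sub_zero, mulForm_quad] at h2
    have h3 := (hsum (u n - u m)).sum_le_tsum s fun x _ => mul_nonneg (hw x) (sq_nonneg _)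
    exact h3.trans ((le_abs_self _).trans h2.le)
  have hmem : f ∈ (G.mulForm V hV).domain := by
    obtain ⟨N, hN⟩ := key 1 one_pos
    have h1 : (u N : G.L2) - f ∈ (G.mulForm V hV).domain :=
      summable_of_sum_le (fun x => mul_nonneg (hw x) (sq_nonneg _)) (hN N le_rfl)
    simpa using sub_mem (u N).2 h1
  refine ⟨hmem, Metric.tendsto_atTop.2 fun ε hε => ?_⟩
  obtain ⟨N, hN⟩ := key (ε / 2) (half_pos hε)
  refine ⟨N, fun n hn => ?_⟩
  rw [Real.dist_eq, sub_zero, mulForm_quad,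
    abs_of_nonneg (tsum_nonneg fun x => mul_nonneg (hw x) (sq_nonneg _))]
  refine lt_of_le_of_lt ?_ (half_lt_self hε)
  exact Real.tsum_le_of_sum_le (fun x => mul_nonneg (hw x) (sq_nonneg _)) (hN n hn)

/-- The form `mulForm` as a densely defined closed form. -/
def closedMulForm (G : WeightedGraph X) (V : X → ℝ) (hV : ∀ x, 0 ≤ V x) : ClosedForm G.L2 where
  toSemiboundedForm := G.mulForm V hV
  dense := G.dense_finSupp.mono (finSupp_le_mulForm V hV)
  closed := mulForm_isClosed V hV

/-- The maximal multiplication operator `u ↦ V u` with domain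
`{u ∈ ℓ²(X, μ) | V u ∈ ℓ²(X, μ)}`. -/
def maxMul (G : WeightedGraph X) (V : X → ℝ) : G.L2 →ₗ.[ℂ] G.L2 where
  domain :=
    { carrier := {u | (fun x => (V x : ℂ) * u x) ∈ G.ellTwo}
      add_mem' := fun {u v} hu hv => by
        have h : (fun x => (V x : ℂ) * (u + v) x) =
            (fun x => (V x : ℂ) * u x) + fun x => (V x : ℂ) * v x := by
          funext x
          simp [mul_add]
        rw [Set.mem_ofPred_eq, h]
        exact G.ellTwo.add_mem hu hv
      zero_mem' := by
        have h : (fun x => (V x : ℂ) * (0 : G.L2) x) = 0 := by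
          funext x
          simp
        rw [Set.mem_ofPred_eq, h]
        exact G.ellTwo.zero_mem
      smul_mem' := fun c u hu => by
        have h : (fun x => (V x : ℂ) * (c • u) x) = c • fun x => (V x : ℂ) * u x := by
          funext x
          simp [mul_left_comm]
        rw [Set.mem_ofPred_eq, h]
        exact G.ellTwo.smul_mem c hu }
  toFun :=
    { toFun := fun u => G.mkL2 (fun x => (V x : ℂ) * (u : G.L2) x) u.2
      map_add' := fun u v => L2.ext fun x => by simp [mul_add]
      map_smul' := fun c u => L2.ext fun x => by simp [mul_left_comm] }

/-! ### The operators of the theorem -/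

/-- The closure of the form `(u, v) ↦ (u, 𝓛_V v)`, `u, v ∈ C_c(X)`. -/
def schrodingerForm (hFC : G.FinitenessCondition) (V : X → ℝ)
    (hb : IsLowerSemibounded (schrodinger hFC V)) : ClosedForm G.L2 :=
  friedrichsForm (schrodinger hFC V) G.dense_finSupp (schrodinger_symmetric hFC V) hb

/-- The Friedrichs extension of the Schrödinger operator with potential `V` on `C_c(X)`. -/
def schrodingerFriedrichs (hFC : G.FinitenessCondition) (V : X → ℝ)
    (hb : IsLowerSemibounded (schrodinger hFC V)) : G.L2 →ₗ.[ℂ] G.L2 :=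
  friedrichsExtension (schrodinger hFC V) G.dense_finSupp (schrodinger_symmetric hFC V) hb

theorem dense_form_domains (hFC : G.FinitenessCondition) {V₁ V₂ : X → ℝ}
    (hb : IsLowerSemibounded (schrodinger hFC V₁)) (hV₂ : ∀ x, 0 ≤ V₂ x) :
    Dense (((schrodingerForm hFC V₁ hb).domain ⊓ (G.closedMulForm V₂ hV₂).domain :
      Submodule ℂ G.L2) : Set G.L2) :=
  G.dense_finSupp.mono (le_inf
    (SemiboundedForm.domain_le_closure (operatorForm_isClosable _ _ _))
    (finSupp_le_mulForm V₂ hV₂))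

end WeightedGraph

end

/-! Both operators come from closed forms, so it suffices that the forms `h_{V₁} + q_{V₂}` and
`h_{V₁+V₂}` coincide (`add_eq_schrodingerForm`). They agree on `C_c(X)`. A sum of closed forms is
closed and the closure is the smallest closed extension, so the sum extends `h_{V₁+V₂}`. The content
is the inclusion of `D(h_{V₁}) ∩ D(q_{V₂})` in `D(h_{V₁+V₂})`.

The difficulty is that finitely supported `u n` with `u n → f` in the form norm of `h_{V₁}` need not
be bounded for `q_{V₂}`. For `f ≥ 0` they are replaced by `v n = min(f, |u n|)`: this is still
finitely supported, converges to `f` in `ℓ²`, and satisfies `q_{V₂}(v n) ≤ q_{V₂}(f)`. Since `min(f,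
g) = (f + g - |f - g|) / 2`, its `h_{V₁}`-norm stays bounded once `f ↦ |f|` does not increase that
norm. So `h_{V₁+V₂}(v n)` is bounded, and lower semicontinuity of closed forms puts `f` into the
domain. General `f` are split into real and imaginary, then positive and negative parts.

Two lemmas carry this. `schrodingerForm_map` is a Beurling–Deny type property for the modulus and
for conjugation: on `C_c(X)` the diagonal part of the form sees only `|u|`, while the off-diagonal
part has the sign that favours contractions. `IsClosed.quad_le_of_tendsto` is the lower
semicontinuity, which also carries that property to the closure. Its proof replaces weak compactness
by nearly minimal elements of convex hulls of tails, so neither `H` nor the form space is assumed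
complete. -/

noncomputable section

open Filter Topology ComplexConjugate

/-! ### Nearly minimal elements of nested convex sets -/

/-- A decreasing sequence of bounded non-empty convex sets in a pre-Hilbert space admits a
Cauchy sequence of points `v n ∈ K n`. -/
theorem exists_cauchySeq_mem_of_antitone_convex {E : Type*} [SeminormedAddCommGroup E]
    [InnerProductSpace ℂ E] {K : ℕ → Set E} (hK : Antitone K) (hconv : ∀ n, Convex ℝ (K n))
    (hne : ∀ n, (K n).Nonempty) {R : ℝ} (hR : ∀ n, ∀ v ∈ K n, ‖v‖ ≤ R) :
    ∃ v : ℕ → E, (∀ n, v n ∈ K n) ∧ CauchySeq v := by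
  let d : ℕ → ℝ := fun n => Metric.infDist 0 (K n)
  have hd0 : ∀ n, 0 ≤ d n := fun n => Metric.infDist_nonneg
  have hle : ∀ n, ∀ v ∈ K n, d n ≤ ‖v‖ := fun n v hv => by
    simpa using Metric.infDist_le_dist_of_mem (x := (0 : E)) hv
  have hmono : Monotone d := fun n m hnm =>
    Metric.infDist_le_infDist_of_subset (hK hnm) (hne m)
  have hbdd : BddAbove (Set.range d) := by
    refine ⟨R, ?_⟩
    rintro _ ⟨n, rfl⟩
    obtain ⟨v, hv⟩ := hne n
    exact (hle n v hv).trans (hR n v hv)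
  have hlim := tendsto_atTop_ciSup hmono hbdd
  set D : ℝ := ⨆ n, d n
  have hdD : ∀ n, d n ≤ D := le_ciSup hbdd
  -- The slack `1 / (n + 1)` is needed because the infimum of the norm on `K n` may not be attained.
  have hex : ∀ n : ℕ, ∃ v ∈ K n, ‖v‖ < d n + 1 / ((n : ℝ) + 1) := fun n => by
    obtain ⟨v, hv, h⟩ := (Metric.infDist_lt_iff (x := (0 : E)) (hne n)).1
      (show d n < d n + 1 / ((n : ℝ) + 1) from lt_add_of_pos_right _ (by positivity))
    exact ⟨v, hv, by simpa using h⟩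
  choose v hvK hv using hex
  -- For `m ≥ n` the midpoint of `v n` and `v m` lies in `K n`, so `‖v n + v m‖ ≥ 2 d n`. The
  -- parallelogram law then bounds `‖v n - v m‖²` by `4 ((D + 1 / (n + 1))² - d n²)`, which tends to
  -- `0` because `d n → D`.
  refine ⟨v, hvK, cauchySeq_of_le_tendsto_0'
    (fun n : ℕ => √(4 * ((D + 1 / ((n : ℝ) + 1)) ^ 2 - d n ^ 2))) (fun n m hnm => ?_) ?_⟩
  · refine Real.le_sqrt_of_sq_le ?_
    have hmid : (1 / 2 : ℝ) • v n + (1 / 2 : ℝ) • v m ∈ K n :=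
      hconv n (hvK n) (hK hnm (hvK m)) (by norm_num) (by norm_num) (by norm_num)
    have h1 : 2 * d n ≤ ‖v n + v m‖ := by
      have h2 := hle n _ hmid
      rw [← smul_add, norm_smul, Real.norm_of_nonneg (by norm_num)] at h2
      linarith
    have h3 := parallelogram_law_with_norm ℂ (v n) (v m)
    have h4 : ‖v n‖ ≤ D + 1 / ((n : ℝ) + 1) := by linarith [hv n, hdD n]
    have h5 : ‖v m‖ ≤ D + 1 / ((n : ℝ) + 1) := by
      have h6 : 1 / ((m : ℝ) + 1) ≤ 1 / ((n : ℝ) + 1) :=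
        one_div_le_one_div_of_le (by positivity) (by simpa using hnm)
      linarith [hv m, hdD m]
    have h7 := pow_le_pow_left₀ (norm_nonneg _) h4 2
    have h8 := pow_le_pow_left₀ (norm_nonneg _) h5 2
    have h9 := pow_le_pow_left₀ (mul_nonneg zero_le_two (hd0 n)) h1 2
    rw [dist_eq_norm]
    nlinarith
  · have h1 := (((tendsto_one_div_add_atTop_nhds_zero_nat (𝕜 := ℝ)).const_add D).pow 2).sub
      (hlim.pow 2)
    simpa using (h1.const_mul 4).sqrt

/-! ### Lower semicontinuity of closed forms and minimality of the closure -/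

namespace SemiboundedForm

variable {H : Type*} [NormedAddCommGroup H] [InnerProductSpace ℂ H] {t : SemiboundedForm H}

/-- The embedding of the form space into `H`. -/
def formSpaceSubtype (t : SemiboundedForm H) : t.FormSpace →ₗ[ℂ] H :=
  t.domain.subtype ∘ₗ t.toFS.symm.toLinearMap

/-- A closed form is lower semicontinuous with respect to convergence in `H`. -/
theorem IsClosed.quad_le_of_tendsto (ht : t.IsClosed) {u : ℕ → t.domain} {x : H}
    (hu : Tendsto (fun n => (u n : H)) atTop (𝓝 x)) {M : ℕ → ℝ} {m : ℝ}
    (hM : Tendsto M atTop (𝓝 m)) (hle : ∀ n, t.quad (u n) ≤ M n) :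
    ∃ hx : x ∈ t.domain, t.quad ⟨x, hx⟩ ≤ m := by
  -- The bound on the quadratic form, shifted to a bound on the squared form norm.
  let r2 : ℕ → ℝ := fun n => M n + (1 - t.bound) * ‖(u n : H)‖ ^ 2
  have hr2 : ∀ n, ‖t.toFS (u n)‖ ^ 2 ≤ r2 n := fun n => by
    rw [norm_toFS_sq]
    exact add_le_add_left (hle n) _
  have hr2lim : Tendsto r2 atTop (𝓝 (m + (1 - t.bound) * ‖x‖ ^ 2)) :=
    hM.add ((hu.norm.pow 2).const_mul _)
  have hlim0 : 0 ≤ m + (1 - t.bound) * ‖x‖ ^ 2 :=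
    ge_of_tendsto' hr2lim fun n => (sq_nonneg _).trans (hr2 n)
  have hr : ∀ n, ‖t.toFS (u n)‖ ≤ √(r2 n) := fun n => Real.le_sqrt_of_sq_le (hr2 n)
  have hrlim := hr2lim.sqrt
  obtain ⟨R, hR⟩ := hrlim.bddAbove_range
  -- `K n` is the convex hull of the tail from `n` on. Norm bounds in the form space and closeness
  -- to `x` in `H` both pass from the tail to its hull, since balls are convex; the hulls
  -- additionally contain a form-Cauchy choice of points.
  let A : ℕ → Set t.FormSpace := fun n => (fun j => t.toFS (u j)) '' Set.Ici n
  let K : ℕ → Set t.FormSpace := fun n => convexHull ℝ (A n)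
  have hball : ∀ n (c : ℝ), (∀ j ≥ n, ‖t.toFS (u j)‖ ≤ c) → ∀ v ∈ K n, ‖v‖ ≤ c := by
    intro n c hc v hv
    have h1 : K n ⊆ Metric.closedBall 0 c := by
      refine convexHull_min ?_ (convex_closedBall 0 c)
      rintro _ ⟨j, hj, rfl⟩
      simpa using hc j hj
    simpa using h1 hv
  obtain ⟨v, hvK, hvC⟩ := exists_cauchySeq_mem_of_antitone_convex (K := K)
    (fun n k hnk => convexHull_mono (Set.image_mono (Set.Ici_subset_Ici.2 hnk)))
    (fun n => convex_convexHull ℝ _)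
    (fun n => ⟨_, subset_convexHull ℝ _ ⟨n, Set.self_mem_Ici, rfl⟩⟩)
    (fun n => hball n R fun j _ => (hr j).trans (hR ⟨j, rfl⟩))
  have hvx : Tendsto (fun n => ((t.toFS.symm (v n) : t.domain) : H)) atTop (𝓝 x) := by
    rw [Metric.tendsto_atTop]
    intro ε hε
    obtain ⟨N, hN⟩ := Metric.tendsto_atTop.1 hu (ε / 2) (half_pos hε)
    refine ⟨N, fun n hn => lt_of_le_of_lt ?_ (half_lt_self hε)⟩
    have h1 : K n ⊆ (t.formSpaceSubtype.restrictScalars ℝ) ⁻¹' Metric.closedBall x (ε / 2) := by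
      refine convexHull_min ?_ ((convex_closedBall x _).linear_preimage _)
      rintro _ ⟨j, hj, rfl⟩
      exact (hN j (le_trans hn hj)).le
    exact h1 (hvK n)
  have hvt : t.ConvergesTo (fun n => t.toFS.symm (v n)) x := by
    rw [convergesTo_iff]
    exact ⟨hvx, by simpa using hvC⟩
  -- Closedness takes the place of completeness: the form-Cauchy sequence `v` has the form limit
  -- `x`.
  obtain ⟨hx, hq⟩ := ht _ x hvt
  refine ⟨hx, ?_⟩
  have h1 : Tendsto (fun n => ‖t.toFS (t.toFS.symm (v n) - ⟨x, hx⟩)‖) atTop (𝓝 0) := by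
    rw [tendsto_toFS_iff]
    exact ⟨by simpa using hvx.sub_const x, hq⟩
  have h2 : Tendsto v atTop (𝓝 (t.toFS ⟨x, hx⟩)) := by
    rw [tendsto_iff_norm_sub_tendsto_zero]
    simpa using h1
  -- For every `ε > 0`, a late tail of `u`, hence its hull, lies in the ball whose radius is the
  -- limiting bound plus `ε`.
  have h3 : ‖t.toFS ⟨x, hx⟩‖ ≤ √(m + (1 - t.bound) * ‖x‖ ^ 2) := by
    refine le_of_forall_pos_le_add fun ε hε => ?_
    obtain ⟨N, hN⟩ := (hrlim.eventually_le_const (lt_add_of_pos_right _ hε)).exists_forall_of_atTop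
    refine le_of_tendsto h2.norm ?_
    filter_upwards [eventually_ge_atTop N] with n hn
    exact hball n _ (fun j hj => (hr j).trans (hN j (hn.trans hj))) _ (hvK n)
  have h4 := pow_le_pow_left₀ (norm_nonneg _) h3 2
  rw [Real.sq_sqrt hlim0, norm_toFS_sq] at h4
  linarith

/-- Closedness identifies the form limit with the limit in `H`; together, the convergences in `H`
and of the quadratic form are convergence in the form norm. -/
theorem ConvergesTo.tendsto_toFS (ht : t.IsClosed) {u : ℕ → t.domain} {x : t.domain}
    (hu : t.ConvergesTo u x) : Tendsto (fun n => t.toFS (u n)) atTop (𝓝 (t.toFS x)) := by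
  obtain ⟨hx, hq⟩ := ht _ _ hu
  rw [tendsto_iff_norm_sub_tendsto_zero]
  simp only [← map_sub]
  rw [tendsto_toFS_iff]
  exact ⟨by simpa using hu.1.sub_const (x : H), hq⟩

/-- The form is its form inner product minus a multiple of the inner product of `H`, and both are
jointly continuous. -/
theorem ConvergesTo.tendsto_form_apply (ht : t.IsClosed) {u v : ℕ → t.domain} {x y : t.domain}
    (hu : t.ConvergesTo u x) (hv : t.ConvergesTo v y) :
    Tendsto (fun n => t.form (u n) (v n)) atTop (𝓝 (t.form x y)) := by
  have h1 := ((hu.tendsto_toFS ht).inner (𝕜 := ℂ) (hv.tendsto_toFS ht)).sub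
    ((hu.1.inner (𝕜 := ℂ) hv.1).const_mul ((1 - t.bound : ℝ) : ℂ))
  simpa [inner_toFS] using h1

theorem closure_form (ht : t.IsClosable) (u v : t.domain) :
    (t.closure ht).form (Submodule.inclusion (domain_le_closure ht) u)
      (Submodule.inclusion (domain_le_closure ht) v) = t.form u v :=
  tendsto_nhds_unique (tendsto_closureValue ht
    (x := Submodule.inclusion (domain_le_closure ht) u)
    (y := Submodule.inclusion (domain_le_closure ht) v) (convergesTo_const u) (convergesTo_const v))
    tendsto_const_nhds

/-- The form `s` extends the form `t`. -/
def Extends (s t : SemiboundedForm H) : Prop :=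
  ∃ h : t.domain ≤ s.domain, ∀ u v : t.domain,
    s.form (Submodule.inclusion h u) (Submodule.inclusion h v) = t.form u v

/-- The closure of `t` is the smallest closed extension of `t`. -/
theorem Extends.closure {s : SemiboundedForm H} (hst : s.Extends t) (hs : s.IsClosed)
    (ht : t.IsClosable) : s.Extends (t.closure ht) := by
  obtain ⟨h, hform⟩ := hst
  -- The notion of `t`-convergence involves the form only on differences of elements of `D(t)`,
  -- where `s` and `t` agree.
  have hconv : ∀ {u : ℕ → t.domain} {x : H}, t.ConvergesTo u x →
      s.ConvergesTo (fun n => Submodule.inclusion h (u n)) x := by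
    intro u x hu
    refine ⟨hu.1, hu.2.congr fun p => ?_⟩
    rw [quad, quad, ← hform, map_sub]
  have hle : (t.closure ht).domain ≤ s.domain := by
    rintro x ⟨u, hu⟩
    exact (hs _ x (hconv hu)).1
  refine ⟨hle, fun x y => ?_⟩
  obtain ⟨u, hu⟩ := x.2
  obtain ⟨v, hv⟩ := y.2
  have h1 := ConvergesTo.tendsto_form_apply hs (x := Submodule.inclusion hle x)
    (y := Submodule.inclusion hle y) (hconv hu) (hconv hv)
  simp only [hform] at h1
  exact tendsto_nhds_unique h1 (tendsto_closureValue ht hu hv)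

/-- Each `x` in the domain of the closure is the limit of `u n ∈ D(t)` with `u n → x` in the
form norm of the closure. -/
theorem exists_tendsto_toFS_closure (ht : t.IsClosable) (x : (t.closure ht).domain) :
    ∃ u : ℕ → t.domain, Tendsto (fun n => (u n : H)) atTop (𝓝 x) ∧
      Tendsto (fun n => (t.closure ht).toFS (Submodule.inclusion (domain_le_closure ht) (u n)))
        atTop (𝓝 ((t.closure ht).toFS x)) := by
  obtain ⟨u, hu⟩ := x.2
  refine ⟨u, hu.1, ConvergesTo.tendsto_toFS (closure_isClosed ht) ⟨hu.1, hu.2.congr fun p => ?_⟩⟩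
  rw [← closure_quad ht, map_sub]

end SemiboundedForm

/-! ### Equality of closed forms and their operators -/

namespace ClosedForm

variable {H : Type*} [NormedAddCommGroup H] [InnerProductSpace ℂ H]

/-- Apart from the domain and the form, all fields of a closed form are proofs. -/
theorem eq_of_extends {s t : ClosedForm H}
    (h : s.toSemiboundedForm.Extends t.toSemiboundedForm) (hle : s.domain ≤ t.domain) : s = t := by
  obtain ⟨⟨D, F, _, _⟩, _, _⟩ := s
  obtain ⟨⟨D', F', _, _⟩, _, _⟩ := t
  obtain ⟨h1, h2⟩ := h
  obtain rfl : D = D' := le_antisymm hle h1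
  obtain rfl : F = F' := LinearMap.ext₂ h2
  rfl

/-- The defining property of the operator associated with a closed form. -/
theorem form_eq_inner_operator (t : ClosedForm H) (u : t.operator.domain) :
    ∃ hu : (u : H) ∈ t.domain, ∀ v : t.domain,
      t.form v ⟨u, hu⟩ = inner ℂ (v : H) (t.operator u) :=
  ⟨u.2.choose, u.2.choose_spec.choose_spec⟩

end ClosedForm

/-! ### Modulus-preserving contractions of the complex plane -/

/-- A `1`-Lipschitz map of `ℂ` that preserves absolute values. -/
structure ModulusContraction where
  toFun : ℂ → ℂ
  norm_eq : ∀ a, ‖toFun a‖ = ‖a‖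
  norm_sub_le : ∀ a b, ‖toFun a - toFun b‖ ≤ ‖a - b‖

namespace ModulusContraction

instance : CoeFun ModulusContraction fun _ => ℂ → ℂ := ⟨toFun⟩

/-- Complex conjugation. -/
def conjugation : ModulusContraction where
  toFun a := conj a
  norm_eq a := RCLike.norm_conj a
  norm_sub_le a b := by rw [← map_sub, RCLike.norm_conj]

/-- The absolute value. -/
def modulus : ModulusContraction where
  toFun a := (‖a‖ : ℂ)
  norm_eq a := by simp
  norm_sub_le a b := by
    rw [← Complex.ofReal_sub, Complex.norm_real]
    exact abs_norm_sub_norm_le a b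

theorem conjugation_apply (a : ℂ) : conjugation a = conj a := rfl

theorem modulus_apply (a : ℂ) : modulus a = (‖a‖ : ℂ) := rfl

variable (C : ModulusContraction)

theorem apply_eq_zero {a : ℂ} : C a = 0 ↔ a = 0 := by
  rw [← norm_eq_zero, C.norm_eq, norm_eq_zero]

/-- Expand `|a - b|² = |a|² + |b|² - 2 Re(conj a * b)`: `C` keeps the first two terms and does not
increase the left side. -/
theorem re_conj_mul_le (a b : ℂ) : (conj a * b).re ≤ (conj (C a) * C b).re := by
  have h1 := pow_le_pow_left₀ (norm_nonneg _) (C.norm_sub_le a b) 2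
  have h2 := C.norm_eq a
  have h3 := C.norm_eq b
  rw [← sq_eq_sq₀ (norm_nonneg _) (norm_nonneg _)] at h2 h3
  simp only [Complex.sq_norm, Complex.normSq_apply, Complex.sub_re, Complex.sub_im] at h1 h2 h3
  simp only [Complex.mul_re, Complex.conj_re, Complex.conj_im]
  nlinarith

end ModulusContraction

/-! ### Contractions acting on functions and on the Schrödinger form -/

namespace WeightedGraph

variable {X : Type*} {G : WeightedGraph X}

/-- The composition of a function in `ℓ²(X, μ)` with a contraction. -/
def L2.map (C : ModulusContraction) (f : G.L2) : G.L2 :=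
  G.mkL2 (fun x => C (f x)) (by
    have h : Summable fun x => G.μ x * ‖f x‖ ^ 2 := f.mem
    exact h.congr fun x => by rw [C.norm_eq])

@[simp] theorem L2.map_apply (C : ModulusContraction) (f : G.L2) (x : X) :
    f.map C x = C (f x) := rfl

theorem L2.norm_le_norm {f g : G.L2} (h : ∀ x, ‖f x‖ ≤ ‖g x‖) : ‖f‖ ≤ ‖g‖ := by
  have hf : Summable fun x => G.μ x * ‖f x‖ ^ 2 := f.mem
  have hg : Summable fun x => G.μ x * ‖g x‖ ^ 2 := g.mem
  refine le_of_sq_le_sq ?_ (norm_nonneg _)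
  rw [norm_sq_eq, norm_sq_eq]
  exact hf.tsum_le_tsum (fun x => mul_le_mul_of_nonneg_left
    (pow_le_pow_left₀ (norm_nonneg _) (h x) 2) (G.μ_pos x).le) hg

theorem L2.norm_map (C : ModulusContraction) (f : G.L2) : ‖f.map C‖ = ‖f‖ :=
  le_antisymm (L2.norm_le_norm fun _ => (C.norm_eq _).le)
    (L2.norm_le_norm fun _ => (C.norm_eq _).ge)

/-- A sequence that is pointwise closer to `f` than a sequence convergent to `f` converges to
`f`. -/
theorem L2.tendsto_of_norm_sub_le {u v : ℕ → G.L2} {f g : G.L2}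
    (hu : Tendsto u atTop (𝓝 f)) (h : ∀ n x, ‖v n x - g x‖ ≤ ‖u n x - f x‖) :
    Tendsto v atTop (𝓝 g) := by
  rw [tendsto_iff_norm_sub_tendsto_zero] at hu ⊢
  exact squeeze_zero (fun _ => norm_nonneg _) (fun n => L2.norm_le_norm fun x => h n x) hu

theorem map_mem_finSupp (C : ModulusContraction) {f : G.L2} (hf : f ∈ G.finSupp) :
    f.map C ∈ G.finSupp :=
  Set.Finite.subset hf fun _ hx h => hx (C.apply_eq_zero.2 h)

theorem map_mem_mulForm (C : ModulusContraction) {V : X → ℝ} {hV : ∀ x, 0 ≤ V x} {f : G.L2}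
    (hf : f ∈ (G.mulForm V hV).domain) : f.map C ∈ (G.mulForm V hV).domain := by
  have h : Summable fun x => G.μ x * V x * ‖f x‖ ^ 2 := hf
  exact h.congr fun x => by rw [L2.map_apply, C.norm_eq]

/-- The form of the Schrödinger operator on `C_c(X)`. -/
def minimalForm (hFC : G.FinitenessCondition) (V : X → ℝ)
    (hb : IsLowerSemibounded (schrodinger hFC V)) : SemiboundedForm G.L2 :=
  operatorForm (schrodinger hFC V) (schrodinger_symmetric hFC V) hb

theorem minimalForm_isClosable (hFC : G.FinitenessCondition) (V : X → ℝ)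
    (hb : IsLowerSemibounded (schrodinger hFC V)) : (minimalForm hFC V hb).IsClosable :=
  operatorForm_isClosable _ _ _

/-- Separates a diagonal part, which for `u = v` depends on `|u|` only, from an off-diagonal part
with weights `-b ≤ 0`, so that contractions can be compared term by term. The inner sum in the
diagonal coefficient runs over all of `X`, not only over `s`. -/
theorem inner_schrodinger_eq_sum (hFC : G.FinitenessCondition) (V : X → ℝ) (u v : G.finSupp)
    {s : Finset X} (hu : (G.toFun (u : G.L2)).support ⊆ s)
    (hv : (G.toFun (v : G.L2)).support ⊆ s) :
    inner ℂ (u : G.L2) (schrodinger hFC V v) =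
      ∑ x ∈ s, (((∑' y, G.b x y + G.μ x * V x : ℝ) : ℂ) * (conj ((u : G.L2) x) * (v : G.L2) x) -
        ∑ y ∈ s, (G.b y x : ℂ) * (conj ((u : G.L2) x) * (v : G.L2) y)) := by
  have hu0 : ∀ x ∉ s, (u : G.L2) x = 0 := fun x hx => by
    by_contra h
    exact hx (hu h)
  rw [inner_def, tsum_eq_sum (s := s) fun x hx => by simp [hu0 x hx]]
  refine Finset.sum_congr rfl fun x _ => ?_
  have hμ : (G.μ x : ℂ) ≠ 0 := Complex.ofReal_ne_zero.2 (G.μ_pos x).ne'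
  rw [schrodinger_apply, G.formalSchrodinger_eq V hv]
  simp only [Complex.ofReal_div, Complex.ofReal_add, Complex.ofReal_mul]
  rw [mul_sub, mul_sub, Finset.mul_sum, Finset.mul_sum]
  congr 1
  · field_simp [hμ]
  · refine Finset.sum_congr rfl fun y _ => ?_
    field_simp [hμ]

/-- Diagonal terms are unchanged because `C` preserves moduli. The products in the off-diagonal
terms increase by `re_conj_mul_le` and enter with the weights `-b ≤ 0`. The sign of `V` plays no
role. -/
theorem minimalForm_quad_map_le (hFC : G.FinitenessCondition) (V : X → ℝ)
    (hb : IsLowerSemibounded (schrodinger hFC V)) (C : ModulusContraction) (u : G.finSupp) :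
    (minimalForm hFC V hb).quad ⟨(u : G.L2).map C, map_mem_finSupp C u.2⟩ ≤
      (minimalForm hFC V hb).quad u := by
  have hu' : (G.toFun (u : G.L2)).support.Finite := u.2
  have hu : (G.toFun (u : G.L2)).support ⊆ hu'.toFinset := hu'.coe_toFinset.ge
  have hCu : (G.toFun ((u : G.L2).map C)).support ⊆ hu'.toFinset := fun x hx =>
    hu fun h => hx (C.apply_eq_zero.2 h)
  let Cu : G.finSupp := ⟨(u : G.L2).map C, map_mem_finSupp C u.2⟩
  change (inner ℂ (Cu : G.L2) (schrodinger hFC V Cu)).re ≤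
    (inner ℂ (u : G.L2) (schrodinger hFC V u)).re
  rw [inner_schrodinger_eq_sum hFC V Cu Cu hCu hCu, inner_schrodinger_eq_sum hFC V u u hu hu]
  simp only [Complex.re_sum, Complex.sub_re, Complex.re_ofReal_mul]
  refine Finset.sum_le_sum fun x _ => sub_le_sub (le_of_eq ?_) (Finset.sum_le_sum fun y _ =>
    mul_le_mul_of_nonneg_left (C.re_conj_mul_le _ _) (G.b_nonneg _ _))
  congr 2
  change conj (C ((u : G.L2) x)) * C ((u : G.L2) x) = _
  rw [Complex.conj_mul', Complex.conj_mul', C.norm_eq]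

section

variable (hFC : G.FinitenessCondition) {V : X → ℝ}
  (hb : IsLowerSemibounded (schrodinger hFC V))

theorem finSupp_le_schrodingerForm : G.finSupp ≤ (schrodingerForm hFC V hb).domain :=
  SemiboundedForm.domain_le_closure (minimalForm_isClosable hFC V hb)

theorem schrodingerForm_form (u v : G.finSupp) :
    (schrodingerForm hFC V hb).form ⟨u, finSupp_le_schrodingerForm hFC hb u.2⟩
      ⟨v, finSupp_le_schrodingerForm hFC hb v.2⟩ = inner ℂ (u : G.L2) (schrodinger hFC V v) :=
  SemiboundedForm.closure_form (minimalForm_isClosable hFC V hb) u v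

/-- Finitely supported functions are dense in the form domain. -/
theorem exists_finSupp_tendsto (f : (schrodingerForm hFC V hb).domain) :
    ∃ u : ℕ → G.finSupp, Tendsto (fun n => (u n : G.L2)) atTop (𝓝 f) ∧
      Tendsto (fun n => (schrodingerForm hFC V hb).toFS
        ⟨u n, finSupp_le_schrodingerForm hFC hb (u n).2⟩) atTop
        (𝓝 ((schrodingerForm hFC V hb).toFS f)) :=
  SemiboundedForm.exists_tendsto_toFS_closure (minimalForm_isClosable hFC V hb) f

/-- The form domain is invariant under `f ↦ C ∘ f`, and this map does not increase the form
norm. -/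
theorem schrodingerForm_map (C : ModulusContraction) (f : (schrodingerForm hFC V hb).domain) :
    ∃ h : (f : G.L2).map C ∈ (schrodingerForm hFC V hb).domain,
      ‖(schrodingerForm hFC V hb).toFS ⟨_, h⟩‖ ≤ ‖(schrodingerForm hFC V hb).toFS f‖ := by
  let t := (schrodingerForm hFC V hb).toSemiboundedForm
  obtain ⟨u, hu, hut⟩ := exists_finSupp_tendsto hFC hb f
  let i : ∀ v ∈ G.finSupp, t.domain := fun v hv => ⟨v, finSupp_le_schrodingerForm hFC hb hv⟩
  have hq : ∀ n, t.quad (i _ (map_mem_finSupp C (u n).2)) ≤ t.quad (i _ (u n).2) := fun n => by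
    have h1 := SemiboundedForm.closure_quad (minimalForm_isClosable hFC V hb) (u n)
    have h2 := SemiboundedForm.closure_quad (minimalForm_isClosable hFC V hb)
      ⟨(u n : G.L2).map C, map_mem_finSupp C (u n).2⟩
    exact h2.le.trans ((minimalForm_quad_map_le hFC V hb C (u n)).trans h1.ge)
  have hlim : Tendsto (fun n => t.quad (i _ (u n).2)) atTop (𝓝 (t.quad f)) := by
    have h1 := (hut.norm.pow 2).sub ((hu.norm.pow 2).const_mul (1 - t.bound))
    simp only [SemiboundedForm.norm_toFS_sq] at h1
    simpa only [t, add_sub_cancel_right] using h1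
  -- The images are only known to converge in `ℓ²`; together with the bound on their forms, this is
  -- all that lower semicontinuity asks for.
  have hmap : Tendsto (fun n => (u n : G.L2).map C) atTop (𝓝 ((f : G.L2).map C)) :=
    L2.tendsto_of_norm_sub_le hu fun n x => C.norm_sub_le _ _
  obtain ⟨h, hle⟩ := (schrodingerForm hFC V hb).closed.quad_le_of_tendsto
    (u := fun n => i _ (map_mem_finSupp C (u n).2)) hmap hlim hq
  refine ⟨h, le_of_sq_le_sq ?_ (norm_nonneg _)⟩
  rw [SemiboundedForm.norm_toFS_sq, SemiboundedForm.norm_toFS_sq]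
  simp only [L2.norm_map]
  exact add_le_add_left hle _

end

/-- The form of the Schrödinger operator with potential `V₁ + V₂` on `C_c(X)` is the sum of the
forms for `V₁` and for multiplication by `V₂`. -/
theorem inner_schrodinger_add (hFC : G.FinitenessCondition) (V₁ : X → ℝ) {V₂ : X → ℝ}
    (hV₂ : ∀ x, 0 ≤ V₂ x) (u v : G.finSupp) :
    inner ℂ (u : G.L2) (schrodinger hFC (V₁ + V₂) v) =
      inner ℂ (u : G.L2) (schrodinger hFC V₁ v) +
        (G.mulForm V₂ hV₂).form ⟨u, finSupp_le_mulForm V₂ hV₂ u.2⟩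
          ⟨v, finSupp_le_mulForm V₂ hV₂ v.2⟩ := by
  let w : G.L2 := G.mkL2 (fun x => (V₂ x : ℂ) * (v : G.L2) x)
    (G.mem_ellTwo_of_finite (Set.Finite.subset v.2 fun x hx => right_ne_zero_of_mul hx))
  have h : schrodinger hFC (V₁ + V₂) v = schrodinger hFC V₁ v + w := by
    refine L2.ext fun x => ?_
    rw [L2.add_apply, schrodinger_apply, schrodinger_apply]
    simp only [formalSchrodinger, Pi.add_apply, w, mkL2_apply]
    push_cast
    ring
  rw [h, inner_add_right]
  congr 1
  rw [inner_def]
  change _ = ∑' x, ((G.μ x * V₂ x : ℝ) : ℂ) * (conj ((u : G.L2) x) * (v : G.L2) x)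
  refine tsum_congr fun x => ?_
  simp only [w, mkL2_apply]
  push_cast
  ring

/-! ### Comparison of the form-sum with the form for the sum of the potentials -/

section FormSum

variable (hFC : G.FinitenessCondition) {V₁ V₂ : X → ℝ} (hV₂ : ∀ x, 0 ≤ V₂ x)
  (hb : IsLowerSemibounded (schrodinger hFC V₁))

/-- The form of `V₁ + V₂` is a restriction of the sum of the forms of `V₁` and `V₂`. -/
theorem add_extends_schrodingerForm :
    ((schrodingerForm hFC V₁ hb).toSemiboundedForm.add (G.mulForm V₂ hV₂)).Extends
      (schrodingerForm hFC (V₁ + V₂)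
        (schrodinger_add_lowerSemibounded hFC hV₂ hb)).toSemiboundedForm := by
  -- By minimality of the closure, it suffices to compare the two forms on `C_c(X)`.
  refine SemiboundedForm.Extends.closure ?_
    (SemiboundedForm.add_isClosed (schrodingerForm hFC V₁ hb).closed (mulForm_isClosed V₂ hV₂))
    (minimalForm_isClosable hFC (V₁ + V₂) _)
  refine ⟨le_inf (finSupp_le_schrodingerForm hFC hb) (finSupp_le_mulForm V₂ hV₂),
    fun (u : G.finSupp) (v : G.finSupp) => ?_⟩
  have h := inner_schrodinger_add hFC V₁ hV₂ u v
  rw [← schrodingerForm_form hFC hb] at h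
  exact h.symm

/-- A non-negative function in both form domains is in the form domain for `V₁ + V₂`: it is
approximated by its minima with non-negative finitely supported functions. -/
theorem mem_schrodingerForm_add_of_nonneg {f : G.L2}
    (hf₁ : f ∈ (schrodingerForm hFC V₁ hb).domain) (hf₂ : f ∈ (G.mulForm V₂ hV₂).domain)
    (hf : ∀ x, f x = (‖f x‖ : ℂ)) :
    f ∈ (schrodingerForm hFC (V₁ + V₂)
      (schrodinger_add_lowerSemibounded hFC hV₂ hb)).domain := by
  set hb' := schrodinger_add_lowerSemibounded hFC hV₂ hb
  let t := (schrodingerForm hFC V₁ hb).toSemiboundedForm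
  obtain ⟨u, hu, hut⟩ := exists_finSupp_tendsto hFC hb ⟨f, hf₁⟩
  let φ : ℕ → t.domain := fun n => ⟨u n, finSupp_le_schrodingerForm hFC hb (u n).2⟩
  let N : t.domain → ℝ := fun v => ‖t.toFS v‖
  have hN : ∀ n, ∃ v : G.finSupp, (∀ x, (v : G.L2) x = (min ‖f x‖ ‖(u n : G.L2) x‖ : ℝ)) ∧
      N ⟨v, finSupp_le_schrodingerForm hFC hb v.2⟩ ≤ N ⟨f, hf₁⟩ + N (φ n) := by
    intro n
    obtain ⟨ha, ha'⟩ := schrodingerForm_map hFC hb .modulus (φ n)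
    let a : t.domain := ⟨_, ha⟩
    obtain ⟨hc, hc'⟩ := schrodingerForm_map hFC hb .modulus (⟨f, hf₁⟩ - a)
    let c : t.domain := ⟨_, hc⟩
    -- With `a = |u n|` and `c = |f - a|`, this is `min(f, |u n|)`. Written this way it visibly lies
    -- in the form domain, and `N c ≤ N f + N a` yields `N m ≤ N f + N a ≤ N f + N (φ n)`.
    let m : t.domain := (1 / 2 : ℂ) • (⟨f, hf₁⟩ + a - c)
    have hmx : ∀ x, (m : G.L2) x = (min ‖f x‖ ‖(u n : G.L2) x‖ : ℝ) := by
      intro x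
      have h1 : (m : G.L2) x = (1 / 2 : ℂ) * (f x + (‖(u n : G.L2) x‖ : ℂ) -
        (‖f x - (‖(u n : G.L2) x‖ : ℂ)‖ : ℂ)) := rfl
      rw [h1, hf x, ← Complex.ofReal_sub, Complex.norm_real, Complex.norm_real, norm_norm,
        Real.norm_eq_abs, inf_eq_half_smul_add_sub_abs_sub' ℝ, abs_sub_comm, smul_eq_mul]
      push_cast
      ring
    -- The minimum vanishes wherever `u n` does, so it inherits finite support from `u n`.
    refine ⟨⟨m, Set.Finite.subset (u n).2 fun x hx h => hx ?_⟩, hmx, ?_⟩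
    · change (u n : G.L2) x = 0 at h
      simp [hmx, h]
    · have h1 : N m ≤ (1 / 2) * (N ⟨f, hf₁⟩ + N a + N c) := by
        simp only [N, m, map_smul, norm_smul, map_sub, map_add]
        have : ‖(1 / 2 : ℂ)‖ = 1 / 2 := by norm_num
        rw [this]
        gcongr
        exact (norm_sub_le _ _).trans (add_le_add_left (norm_add_le _ _) _)
      have h2 : N a ≤ N (φ n) := ha'
      have h3 : N c ≤ N ⟨f, hf₁⟩ + N a := by
        refine hc'.trans ?_
        rw [map_sub]
        exact norm_sub_le _ _
      change N m ≤ _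
      linarith
  choose v hvx hvN using hN
  obtain ⟨R, hR⟩ := hut.norm.bddAbove_range
  -- Pointwise, `|min(f, |u n|) - f| ≤ ||u n| - f| ≤ |u n - f|`.
  have hvf : Tendsto (fun n => (v n : G.L2)) atTop (𝓝 f) := by
    refine L2.tendsto_of_norm_sub_le hu fun n x => ?_
    rw [hvx, hf x, ← Complex.ofReal_sub, Complex.norm_real, Complex.norm_real, norm_norm, ← hf x]
    have h1 := abs_norm_sub_norm_le ((u n : G.L2) x) (f x)
    refine le_trans ?_ h1
    rw [Real.norm_eq_abs]
    rcases le_total ‖f x‖ ‖(u n : G.L2) x‖ with h | h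
    · rw [min_eq_left h, sub_self, abs_zero]
      exact abs_nonneg _
    · rw [min_eq_right h]
  let T := (schrodingerForm hFC (V₁ + V₂) hb').toSemiboundedForm
  -- The first two terms bound `h_{V₁}(v n)`, recovered from the form norm by subtracting `(1 -
  -- t.bound) ‖v n‖²`; the absolute value is there because the sign of `1 - t.bound` is not known.
  -- The last term bounds `q_{V₂}(v n)`, since `|v n| ≤ |f|`.
  let B : ℝ := (N ⟨f, hf₁⟩ + R) ^ 2 + |1 - t.bound| * (N ⟨f, hf₁⟩ + R) ^ 2 +
    (G.mulForm V₂ hV₂).quad ⟨f, hf₂⟩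
  have hB : ∀ n, T.quad ⟨v n, finSupp_le_schrodingerForm hFC hb' (v n).2⟩ ≤ B := by
    intro n
    let w : t.domain := ⟨v n, finSupp_le_schrodingerForm hFC hb (v n).2⟩
    have h1 : T.quad ⟨v n, finSupp_le_schrodingerForm hFC hb' (v n).2⟩ = t.quad w +
        (G.mulForm V₂ hV₂).quad ⟨v n, finSupp_le_mulForm V₂ hV₂ (v n).2⟩ := by
      have h := inner_schrodinger_add hFC V₁ hV₂ (v n) (v n)
      rw [← schrodingerForm_form hFC hb, ← schrodingerForm_form hFC hb'] at h
      exact congrArg Complex.re h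
    have h2 : (G.mulForm V₂ hV₂).quad ⟨v n, finSupp_le_mulForm V₂ hV₂ (v n).2⟩ ≤
        (G.mulForm V₂ hV₂).quad ⟨f, hf₂⟩ := by
      rw [mulForm_quad, mulForm_quad]
      refine Summable.tsum_le_tsum (fun x => mul_le_mul_of_nonneg_left ?_
        (mul_nonneg (G.μ_pos x).le (hV₂ x))) (finSupp_le_mulForm V₂ hV₂ (v n).2) hf₂
      refine pow_le_pow_left₀ (norm_nonneg _) ?_ 2
      rw [hvx, Complex.norm_real, Real.norm_of_nonneg (by positivity)]
      exact min_le_left _ _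
    have h3 : N w ≤ N ⟨f, hf₁⟩ + R := (hvN n).trans (by gcongr; exact hR ⟨n, rfl⟩)
    have h4 : N w ^ 2 ≤ (N ⟨f, hf₁⟩ + R) ^ 2 := pow_le_pow_left₀ (norm_nonneg _) h3 2
    have h5 : ‖(w : G.L2)‖ ^ 2 ≤ (N ⟨f, hf₁⟩ + R) ^ 2 :=
      pow_le_pow_left₀ (norm_nonneg _) ((t.norm_le_norm_toFS w).trans h3) 2
    have h6 : N w ^ 2 = t.quad w + (1 - t.bound) * ‖(w : G.L2)‖ ^ 2 := t.norm_toFS_sq w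
    have h7 : -((1 - t.bound) * ‖(w : G.L2)‖ ^ 2) ≤ |1 - t.bound| * (N ⟨f, hf₁⟩ + R) ^ 2 := by
      rw [← neg_mul]
      exact mul_le_mul (neg_le_abs _) h5 (sq_nonneg _) (abs_nonneg _)
    rw [h1]
    linarith
  exact ((schrodingerForm hFC (V₁ + V₂) hb').closed.quad_le_of_tendsto
    (u := fun n => ⟨v n, finSupp_le_schrodingerForm hFC hb' (v n).2⟩) hvf
    tendsto_const_nhds hB).1

/-- For real `f` both `|f| + f` and `|f| - f` are non-negative, they stay in both form domains, and
half their difference is `f`. -/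
theorem mem_schrodingerForm_add_of_real {f : G.L2}
    (hf₁ : f ∈ (schrodingerForm hFC V₁ hb).domain) (hf₂ : f ∈ (G.mulForm V₂ hV₂).domain)
    (hf : ∀ x, conj (f x) = f x) :
    f ∈ (schrodingerForm hFC (V₁ + V₂)
      (schrodinger_add_lowerSemibounded hFC hV₂ hb)).domain := by
  have ha₁ : f.map .modulus ∈ (schrodingerForm hFC V₁ hb).domain :=
    (schrodingerForm_map hFC hb .modulus ⟨f, hf₁⟩).1
  have ha₂ : f.map .modulus ∈ (G.mulForm V₂ hV₂).domain := map_mem_mulForm .modulus hf₂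
  have hp := mem_schrodingerForm_add_of_nonneg hFC hV₂ hb (add_mem ha₁ hf₁) (add_mem ha₂ hf₂)
    fun x => by
      obtain ⟨r, hr⟩ := Complex.conj_eq_iff_real.1 (hf x)
      rw [L2.add_apply, L2.map_apply, ModulusContraction.modulus_apply, hr, Complex.norm_real,
        Real.norm_eq_abs, ← Complex.ofReal_add, Complex.norm_real, Real.norm_of_nonneg]
      linarith [neg_abs_le r]
  have hm := mem_schrodingerForm_add_of_nonneg hFC hV₂ hb (sub_mem ha₁ hf₁) (sub_mem ha₂ hf₂)
    fun x => by
      obtain ⟨r, hr⟩ := Complex.conj_eq_iff_real.1 (hf x)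
      rw [L2.sub_apply, L2.map_apply, ModulusContraction.modulus_apply, hr, Complex.norm_real,
        Real.norm_eq_abs, ← Complex.ofReal_sub, Complex.norm_real, Real.norm_of_nonneg]
      linarith [le_abs_self r]
  have h : f = (1 / 2 : ℂ) • ((f.map .modulus + f) - (f.map .modulus - f)) := by
    refine L2.ext fun x => ?_
    simp only [L2.smul_apply, L2.sub_apply, L2.add_apply]
    ring
  rw [h]
  exact Submodule.smul_mem _ _ (sub_mem hp hm)

/-- The functions `f + conj f` and `i (f - conj f)` are real and stay in both form domains, because
conjugation is a modulus-preserving contraction; `f` is a linear combination of them. -/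
theorem add_domain_le_schrodingerForm :
    (schrodingerForm hFC V₁ hb).domain ⊓ (G.mulForm V₂ hV₂).domain ≤
      (schrodingerForm hFC (V₁ + V₂)
        (schrodinger_add_lowerSemibounded hFC hV₂ hb)).domain := by
  rintro f ⟨hf₁, hf₂⟩
  have hc₁ : f.map .conjugation ∈ (schrodingerForm hFC V₁ hb).domain :=
    (schrodingerForm_map hFC hb .conjugation ⟨f, hf₁⟩).1
  have hc₂ : f.map .conjugation ∈ (G.mulForm V₂ hV₂).domain := map_mem_mulForm .conjugation hf₂
  have hre := mem_schrodingerForm_add_of_real hFC hV₂ hb (add_mem hf₁ hc₁) (add_mem hf₂ hc₂)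
    fun x => by
      simp only [L2.add_apply, L2.map_apply, ModulusContraction.conjugation_apply, map_add,
        Complex.conj_conj]
      ring
  have him := mem_schrodingerForm_add_of_real hFC hV₂ hb
    (Submodule.smul_mem _ Complex.I (sub_mem hf₁ hc₁))
    (Submodule.smul_mem _ Complex.I (sub_mem hf₂ hc₂))
    fun x => by
      simp only [L2.smul_apply, L2.sub_apply, L2.map_apply,
        ModulusContraction.conjugation_apply, map_sub, map_mul, Complex.conj_conj, Complex.conj_I]
      ring
  have h : f = (1 / 2 : ℂ) • ((f + f.map .conjugation) -
      Complex.I • (Complex.I • (f - f.map .conjugation))) := by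
    refine L2.ext fun x => ?_
    simp only [L2.smul_apply, L2.sub_apply, L2.add_apply, ← mul_assoc, Complex.I_mul_I]
    ring
  rw [h]
  exact Submodule.smul_mem _ _ (sub_mem hre (Submodule.smul_mem _ _ him))

/-- The forms themselves coincide, and this gives equality of the operators, domains included. -/
theorem add_eq_schrodingerForm :
    (schrodingerForm hFC V₁ hb).add (G.closedMulForm V₂ hV₂) (dense_form_domains hFC hb hV₂) =
      schrodingerForm hFC (V₁ + V₂) (schrodinger_add_lowerSemibounded hFC hV₂ hb) :=
  ClosedForm.eq_of_extends (add_extends_schrodingerForm hFC hV₂ hb)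
    (add_domain_le_schrodingerForm hFC hV₂ hb)

end FormSum

/-! ### The operator of the multiplication form -/

/-- The maximal multiplication operator is the operator associated with the form of
multiplication. -/
theorem closedMulForm_operator (V : X → ℝ) (hV : ∀ x, 0 ≤ V x) :
    (G.closedMulForm V hV).operator = G.maxMul V := by
  classical
  have hform : ∀ u v : (G.mulForm V hV).domain, (G.mulForm V hV).form u v =
      ∑' x, ((G.μ x * V x : ℝ) : ℂ) * (conj ((u : G.L2) x) * (v : G.L2) x) := fun u v => rfl
  have hval : ∀ (u : (G.closedMulForm V hV).operator.domain) (x : X),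
      (G.closedMulForm V hV).operator u x = (V x : ℂ) * (u : G.L2) x := by
    intro u x
    obtain ⟨hu, h⟩ := (G.closedMulForm V hV).form_eq_inner_operator u
    have hs : (Pi.single x 1 : X → ℂ).support.Finite :=
      (Set.finite_singleton x).subset Pi.support_single_subset
    -- Testing the defining identity of the operator against the indicator of `x` reads off its
    -- value at `x`.
    let δ : G.L2 := G.mkL2 (Pi.single x 1) (G.mem_ellTwo_of_finite hs)
    have hδ : ∀ y ≠ x, δ y = 0 := fun y hy => Pi.single_eq_of_ne hy 1
    have hδx : δ x = 1 := Pi.single_eq_same x 1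
    have h1 := h ⟨δ, finSupp_le_mulForm V hV hs⟩
    refine mul_left_cancel₀ (Complex.ofReal_ne_zero.2 (G.μ_pos x).ne') ?_
    have h2 := (hform _ _).symm.trans h1
    rw [inner_def, tsum_eq_single x fun y hy => by simp [hδ y hy],
      tsum_eq_single x fun y hy => by simp [hδ y hy]] at h2
    simp only [hδx, map_one, one_mul, Complex.ofReal_mul] at h2
    rw [← h2, mul_assoc]
  have hdom : (G.closedMulForm V hV).operator.domain = (G.maxMul V).domain := by
    refine le_antisymm (fun u hu => ?_) fun u hu => ?_
    · have h1 := ((G.closedMulForm V hV).operator ⟨u, hu⟩).mem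
      have h2 : G.toFun ((G.closedMulForm V hV).operator ⟨u, hu⟩) =
        fun x => (V x : ℂ) * u x := funext (hval ⟨u, hu⟩)
      rw [h2] at h1
      exact h1
    · have h1 : Summable fun x => G.μ x * ‖u x‖ ^ 2 := u.mem
      have h2 : Summable fun x => G.μ x * ‖(V x : ℂ) * u x‖ ^ 2 := hu
      -- If `u` and `V u` are in `ℓ²`, then `u` is in the form domain because `V ≤ 1 + V²`, which
      -- follows from `1 + V² - V = (V - 1)² + V` and `V ≥ 0`.
      have h3 : u ∈ (G.mulForm V hV).domain := by
        refine Summable.of_nonneg_of_le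
          (fun x => mul_nonneg (mul_nonneg (G.μ_pos x).le (hV x)) (sq_nonneg _))
          (fun x => ?_) (h1.add h2)
        rw [norm_mul, Complex.norm_real, Real.norm_of_nonneg (hV x), mul_assoc, ← mul_add]
        refine mul_le_mul_of_nonneg_left ?_ (G.μ_pos x).le
        change V x * ‖u x‖ ^ 2 ≤ _
        nlinarith [sq_nonneg ‖u x‖, mul_nonneg (sq_nonneg (V x - 1)) (sq_nonneg ‖u x‖),
          mul_nonneg (hV x) (sq_nonneg ‖u x‖)]
      refine ⟨h3, G.maxMul V ⟨u, hu⟩, fun v => ?_⟩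
      refine (hform _ _).trans ?_
      rw [inner_def]
      refine tsum_congr fun x => ?_
      have h4 : G.maxMul V ⟨u, hu⟩ x = (V x : ℂ) * u x := rfl
      rw [h4]
      push_cast
      ring
  refine LinearPMap.ext hdom fun u hu hu' => L2.ext fun x => ?_
  exact hval ⟨u, hu⟩ x

end WeightedGraph

end

theorem theorem1 {X : Type*} [Countable X] [Nonempty X] (G : WeightedGraph X)
    (hconn : G.Connected) (hFC : G.FinitenessCondition) (V₁ V₂ : X → ℝ)
    (hV₂ : ∀ x, 0 ≤ V₂ x)
    (hb : IsLowerSemibounded (WeightedGraph.schrodinger hFC V₁)) :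
    -- the closed forms that enter the form-sum are those of `L_{V₁}` and of `M_{V₂}`
    (WeightedGraph.schrodingerForm hFC V₁ hb).operator =
        WeightedGraph.schrodingerFriedrichs hFC V₁ hb ∧
      (G.closedMulForm V₂ hV₂).operator = G.maxMul V₂ ∧
    -- the form-sum of `L_{V₁}` and `M_{V₂}` is the Friedrichs extension for `V₁ + V₂`
      ClosedForm.formSum (WeightedGraph.schrodingerForm hFC V₁ hb) (G.closedMulForm V₂ hV₂)
          (WeightedGraph.dense_form_domains hFC hb hV₂) =
        WeightedGraph.schrodingerFriedrichs hFC (V₁ + V₂)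
          (WeightedGraph.schrodinger_add_lowerSemibounded hFC hV₂ hb) := by
  -- The first claim is definitional: the Friedrichs extension is defined as the operator of this
  -- form.
  refine ⟨rfl, WeightedGraph.closedMulForm_operator V₂ hV₂, ?_⟩
  exact congrArg ClosedForm.operator (WeightedGraph.add_eq_schrodingerForm hFC hV₂ hb)
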